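/- **The language.** Types are $A ::= \mathtt{nat}\mid\mathtt{comm}\mid\mathtt{var}\mid A\multimap A$; the base types are $\mathtt{nat},\mathtt{comm},\mathtt{var}$. Terms, up to renaming of bound identifiers, are $$M ::= x\mid\lambda x^A.M\mid MM\mid n\mid M\odot M\mid\mathtt{skip}\mid M;M\mid M:=M\mid{!M}\mid\mathtt{while}\,M\,\mathtt{do}\,M\mid\mathtt{ifzero}\,M\,M\,M\mid\mathtt{new}\,x\,\mathtt{in}\,M\mid\mathtt{random}\mid\mathtt{mkvar}\,M\,N,$$ where $n\in\mathbb N$ and $\odot$ ranges over addition, truncated subtraction and an arbitrary fixed family of further total binary operations on $\mathbb N$. Typing judgments $\Gamma\vdash M:A$ are generated by weakening, exchange, $x:A\vdash x:A$, abstraction (from $\Gamma,x:A\vdash M:B$ infer $\Gamma\vdash\lambda x^A.M:A\multimap B$), affine application (from $\Gamma\vdash M:A\multimap B$ and $\Delta\vdash N:A$, with $\Gamma,\Delta$ having no common identifier, infer $\Gamma,\Delta\vdash MN:B$), and the following rules, in which all subterms share the context $\Gamma$: $n:\mathtt{nat}$; $M\odot N:\mathtt{nat}$ for $M,N:\mathtt{nat}$;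 $\mathtt{skip}:\mathtt{comm}$; $M;N:B$ for $M:\mathtt{comm}$, $N:B$, $B$ a base type; $M:=N:\mathtt{comm}$ for $M:\mathtt{var}$, $N:\mathtt{nat}$; $!M:\mathtt{nat}$ for $M:\mathtt{var}$; $\mathtt{while}\,M\,\mathtt{do}\,N:\mathtt{comm}$ for $M:\mathtt{nat}$, $N:\mathtt{comm}$; $\mathtt{ifzero}\,M\,N_1\,N_2:B$ for $M:\mathtt{nat}$, $N_i:B$, $B$ a base type; $\mathtt{new}\,x\,\mathtt{in}\,M:B$ for $\Gamma,x:\mathtt{var}\vdash M:B$, $B\in\{\mathtt{comm},\mathtt{nat}\}$; $\mathtt{random}:\mathtt{nat}$; $\mathtt{mkvar}\,M\,N:\mathtt{var}$ for $M:\mathtt{nat}\multimap\mathtt{comm}$, $N:\mathtt{nat}$. **Operational semantics.** Let $\Gamma$ contain only identifiers of type $\mathtt{var}$; a store $\sigma$ assigns a number to each of them. Values $V$ are numerals, $\mathtt{skip}$, identifiers of type $\mathtt{var}$, abstractions and terms $\mathtt{mkvar}\,M\,N$. The relation $\sigma,M\Downarrow\sigma',V$ is the least one such that: - $\sigma,V\Downarrow\sigma,V$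 for each value $V$, and $\sigma,\mathtt{random}\Downarrow\sigma,n$ for every $n$; - if $\sigma,M\Downarrow\sigma',\lambda x.M'$ and $\sigma',M'[N/x]\Downarrow\sigma'',V$, then $\sigma,MN\Downarrow\sigma'',V$; - if $\sigma,M_1\Downarrow\sigma',n_1$ and $\sigma',M_2\Downarrow\sigma'',n_2$, then $\sigma,M_1\odot M_2\Downarrow\sigma'',n_1\odot n_2$; - if $\sigma,M\Downarrow\sigma',\mathtt{skip}$ and $\sigma',N\Downarrow\sigma'',V$, then $\sigma,(M;N)\Downarrow\sigma'',V$; - if $\sigma,N\Downarrow\sigma',n$ and $\sigma',M\Downarrow\sigma'',x$, then $\sigma,(M:=N)\Downarrow\sigma''[x\mapsto n],\mathtt{skip}$; if instead $\sigma',M\Downarrow\sigma'',\mathtt{mkvar}\,M_1\,M_2$ and $\sigma'',M_1n\Downarrow\sigma''',V$, then $\sigma,(M:=N)\Downarrow\sigma''',V$; - if $\sigma,M\Downarrow\sigma',x$, then $\sigma,{!M}\Downarrow\sigma',\sigma'(x)$; if $\sigma,M\Downarrow\sigma',\mathtt{mkvar}\,M_1\,M_2$ and $\sigma',M_2\Downarrow\sigma'',V$,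 then $\sigma,{!M}\Downarrow\sigma'',V$; - if $\sigma,M\Downarrow\sigma',n$ with $n\ne0$, then $\sigma,\mathtt{while}\,M\,\mathtt{do}\,N\Downarrow\sigma',\mathtt{skip}$; if $\sigma,M\Downarrow\sigma',0$, $\sigma',N\Downarrow\sigma'',\mathtt{skip}$ and $\sigma'',\mathtt{while}\,M\,\mathtt{do}\,N\Downarrow\sigma''',\mathtt{skip}$, then $\sigma,\mathtt{while}\,M\,\mathtt{do}\,N\Downarrow\sigma''',\mathtt{skip}$; - if $\sigma,M\Downarrow\sigma',n$ and $\sigma',N_i\Downarrow\sigma'',V$, where $i=1$ if $n=0$ and $i=2$ otherwise, then $\sigma,\mathtt{ifzero}\,M\,N_1\,N_2\Downarrow\sigma'',V$; - if $\sigma[x\mapsto0],M\Downarrow\sigma'[x\mapsto n],V$ with $x$ fresh and not occurring in $V$, then $\sigma,\mathtt{new}\,x\,\mathtt{in}\,M\Downarrow\sigma',V$. For closed terms, $M\Downarrow V$ refers to the empty store. Closed terms $M,N$ of the same type are contextually equivalent, $M\cong_{\mathtt{mk},\mathtt{ran}}N$, if for every context $C[-]$ of the language with $\vdash C[M],C[N]:B$,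 $B\in\{\mathtt{comm},\mathtt{nat}\}$, and every value $\vdash V:B$, $C[M]\Downarrow V\iff C[N]\Downarrow V$. **The model.** $\mathbf{MonRel}$ is the category whose objects are monoids, a map $X\to Y$ being a monoid homomorphism from $Y$ to the monoid $\mathcal P X$ of subsets of $X$ (with $ST=\{xy\mid x\in S,y\in T\}$), composed as relations. Let $\alpha\,\mathtt{nat}=\mathbb N$, $\alpha\,\mathtt{comm}=\{*\}$, $\alpha\,\mathtt{var}=\{\mathsf{read}(n),\mathsf{write}(n)\mid n\in\mathbb N\}$, $\alpha(A\multimap B)=(\alpha A)^*\times\alpha B$. A type $A$ denotes the free monoid $(\alpha A)^*$, and $x_1:A_1,\dots,x_n:A_n\vdash M:B$ denotes a map $[\![M]\!]:(\alpha A_1)^*\times\cdots\times(\alpha A_n)^*\to(\alpha B)^*$ in $\mathbf{MonRel}$, equivalently a set of tuples $(\vec s,b)$ with $s_i\in(\alpha A_i)^*$, $b\in\alpha B$. Writing $\vec s\vec t$ for componentwise concatenation and $\vec\varepsilon$ for the tuple of empty sequences, these sets are given by: - $[\![x:A\vdash x]\!]=\{(a,a)\}$; weakening puts $\varepsilon$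 at the new identifier, and exchange permutes components; - $(\vec s,(s,b))\in[\![\lambda x.M]\!]$ iff $(\vec s,s,b)\in[\![M]\!]$; - $[\![\Gamma,\Delta\vdash MN]\!]$ consists of the tuples $(\vec s,\vec t^1\cdots\vec t^k,b)$ such that for some $a_1,\dots,a_k$, $(\vec s,(a_1\cdots a_k,b))\in[\![M]\!]$ and $(\vec t^i,a_i)\in[\![N]\!]$ for all $i$; - $[\![n]\!]=\{(\vec\varepsilon,n)\}$, $[\![\mathtt{skip}]\!]=\{(\vec\varepsilon,*)\}$, $[\![\mathtt{random}]\!]=\{(\vec\varepsilon,n)\mid n\in\mathbb N\}$; - $[\![M\odot N]\!]=\{(\vec s\vec t,m\odot n)\mid(\vec s,m)\in[\![M]\!],(\vec t,n)\in[\![N]\!]\}$; - $[\![M;N]\!]=\{(\vec s\vec t,b)\mid(\vec s,*)\in[\![M]\!],(\vec t,b)\in[\![N]\!]\}$; - $[\![M:=N]\!]=\{(\vec s\vec t,*)\mid\exists n.\ (\vec s,n)\in[\![N]\!],(\vec t,\mathsf{write}(n))\in[\![M]\!]\}$ and $[\![!M]\!]=\{(\vec s,n)\mid(\vec s,\mathsf{read}(n))\in[\![M]\!]\}$;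 - $[\![\mathtt{while}\,M\,\mathtt{do}\,N]\!]$ consists of the tuples $(\vec s^1\vec t^1\cdots\vec s^j\vec t^j\vec s,*)$ with $j\ge0$, $(\vec s^i,0)\in[\![M]\!]$ and $(\vec t^i,*)\in[\![N]\!]$ for all $i$, and $(\vec s,m)\in[\![M]\!]$ for some $m\neq0$; - $[\![\mathtt{ifzero}\,M\,N_1\,N_2]\!]$ consists of the tuples $(\vec s\vec t,b)$ such that either $(\vec s,0)\in[\![M]\!]$ and $(\vec t,b)\in[\![N_1]\!]$, or $(\vec s,m)\in[\![M]\!]$ for some $m\ne0$ and $(\vec t,b)\in[\![N_2]\!]$; - $[\![\mathtt{new}\,x\,\mathtt{in}\,M]\!]=\{(\vec s,b)\mid(\vec s,s,b)\in[\![M]\!]\text{ for some cell-trace }s\}$, a cell-trace being a sequence in which each $\mathsf{read}$ carries the value of the most recent $\mathsf{write}$, or $0$ if there is none; - $[\![\mathtt{mkvar}\,M\,N]\!]=\{(\vec s,\mathsf{write}(n))\mid(\vec s,*)\in[\![Mn]\!]\}\cup\{(\vec s,\mathsf{read}(n))\mid(\vec s,n)\in[\![N]\!]\}$. **Theorem (full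 abstraction).** For any closed terms $M$ and $N$ of the same type, $$[\![M]\!]=[\![N]\!]\iff M\cong_{\mathtt{mk},\mathtt{ran}}N .$$ -/

import Mathlib

open CategoryTheory
open scoped Pointwise

/-! ## The category of monoids and relations -/

/-- An object of `MonRel`: a monoid. -/
structure MonRel where
  of ::
  carrier : Type
  [str : Monoid carrier]

attribute [instance] MonRel.str

namespace MonRel

/-- `MonRel` is the opposite of the Kleisli category of the powerset monad on monoids: a map
`A ⟶ B` is a monoid homomorphism from `B` to the monoid of subsets of `A` (with
`S * T = {x * y | x ∈ S, y ∈ T}` and `1 = {1}`); equivalently, `f` is the relation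
`{(a, b) | a ∈ f b}` from `A` to `B`, identities and composition being those of relations. -/
instance : Category MonRel where
  Hom A B := B.carrier →* Set A.carrier
  id A := Set.singletonMonoidHom
  comp {A B C} f g :=
    { toFun := fun c => {a | ∃ b, b ∈ g c ∧ a ∈ f b}
      map_one' := by
        ext a
        simp [map_one]
      map_mul' := by
        intro c d
        ext a
        simp only [map_mul, Set.mem_mul, Set.mem_ofPred_eq]
        constructor
        · rintro ⟨_, ⟨b, hb, b', hb', rfl⟩, ha⟩
          rw [map_mul, Set.mem_mul] at ha
          obtain ⟨x, hx, y, hy, rfl⟩ := ha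
          exact ⟨x, ⟨b, hb, hx⟩, y, ⟨b', hb', hy⟩, rfl⟩
        · rintro ⟨x, ⟨b, hb, hx⟩, y, ⟨b', hb', hy⟩, rfl⟩
          refine ⟨b * b', ⟨b, hb, b', hb', rfl⟩, ?_⟩
          rw [map_mul]
          exact Set.mul_mem_mul hx hy }
  id_comp {A B} f := by
    ext b a
    change (∃ b', b' ∈ f b ∧ a ∈ ({b'} : Set A.carrier)) ↔ a ∈ f b
    simp
  comp_id {A B} f := by
    ext b a
    change (∃ b', b' ∈ ({b} : Set B.carrier) ∧ a ∈ f b') ↔ a ∈ f b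
    simp
  assoc {A B C D} f g h := by
    ext d a
    change (∃ c, c ∈ h d ∧ ∃ b, b ∈ g c ∧ a ∈ f b) ↔ (∃ b, (∃ c, c ∈ h d ∧ b ∈ g c) ∧ a ∈ f b)
    constructor
    · rintro ⟨c, hc, b, hb, ha⟩
      exact ⟨b, ⟨c, hc, hb⟩, ha⟩
    · rintro ⟨b, ⟨c, hc, hb⟩, ha⟩
      exact ⟨c, hc, b, hb, ha⟩

/-- The map `A ⟶ C*` into a free monoid given by a set of pairs `(a, c)`. (Every map `A ⟶ C*`
arises from exactly one such set, `FreeMonoid.lift` being an equivalence.) -/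
def ofPairs {A : MonRel} {C : Type} (S : Set (A.carrier × C)) : A ⟶ MonRel.of (FreeMonoid C) :=
  FreeMonoid.lift (fun c => {a | (a, c) ∈ S})

end MonRel

namespace SCI

/-! ## Types, identifiers and terms -/

inductive Ty where
  | nat : Ty
  | comm : Ty
  | var : Ty
  | fn : Ty → Ty → Ty

/-- The base types `nat`, `comm`, `var`. -/
def Ty.IsBase : Ty → Prop
  | .fn _ _ => False
  | _ => True

/-- The types `nat`, `comm`. -/
def Ty.IsGround : Ty → Prop
  | .nat => True
  | .comm => True
  | _ => False

/-- A typing context: the list of the types of the identifiers in scope. -/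
abbrev Cxt := List Ty

/-- `Var Γ A`: the identifiers of type `A` in `Γ` (de Bruijn indices, so that terms are
identified up to renaming of bound identifiers). -/
inductive Var : Cxt → Ty → Type where
  | z {Γ : Cxt} {A : Ty} : Var (A :: Γ) A
  | s {Γ : Cxt} {A B : Ty} : Var Γ A → Var (B :: Γ) A
  deriving DecidableEq

/-- Binary arithmetic operations: addition, subtraction, and an arbitrary family of further
operations indexed by `E`. -/
inductive Op (E : Type) where
  | add : Op E
  | sub : Op E
  | ext : E → Op E

/-- The function on natural numbers denoted by an operation, the further ones being interpreted
by `δ`; subtraction is truncated. -/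
def Op.eval {E : Type} (δ : E → ℕ → ℕ → ℕ) : Op E → ℕ → ℕ → ℕ
  | .add, m, n => m + n
  | .sub, m, n => m - n
  | .ext e, m, n => δ e m n

/-- Simply typed phrases of the language with `random` and `mkvar`. The terms of the language are
those that also obey the affine discipline, `Term.IsAffine` below. -/
inductive Term (E : Type) : Cxt → Ty → Type where
  | var {Γ : Cxt} {A : Ty} (x : Var Γ A) : Term E Γ A
  | lam {Γ : Cxt} {A B : Ty} (M : Term E (A :: Γ) B) : Term E Γ (.fn A B)
  | app {Γ : Cxt} {A B : Ty} (M : Term E Γ (.fn A B)) (N : Term E Γ A) : Term E Γ B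
  | num {Γ : Cxt} (n : ℕ) : Term E Γ .nat
  | op {Γ : Cxt} (o : Op E) (M N : Term E Γ .nat) : Term E Γ .nat
  | skip {Γ : Cxt} : Term E Γ .comm
  | seq {Γ : Cxt} {B : Ty} (hB : B.IsBase) (M : Term E Γ .comm) (N : Term E Γ B) : Term E Γ B
  | assign {Γ : Cxt} (M : Term E Γ .var) (N : Term E Γ .nat) : Term E Γ .comm
  | deref {Γ : Cxt} (M : Term E Γ .var) : Term E Γ .nat
  | whileDo {Γ : Cxt} (M : Term E Γ .nat) (N : Term E Γ .comm) : Term E Γ .comm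
  | ifzero {Γ : Cxt} {B : Ty} (hB : B.IsBase) (M : Term E Γ .nat) (N₁ N₂ : Term E Γ B) : Term E Γ B
  | new {Γ : Cxt} {B : Ty} (hB : B.IsGround) (M : Term E (.var :: Γ) B) : Term E Γ B
  | random {Γ : Cxt} : Term E Γ .nat
  | mkvar {Γ : Cxt} (M : Term E Γ (.fn .nat .comm)) (N : Term E Γ .nat) : Term E Γ .var

namespace Term

variable {E : Type}

/-- The set of free identifiers of a term. -/
def FV : {Γ : Cxt} → {A : Ty} → Term E Γ A → Set (Σ C : Ty, Var Γ C)
  | _, _, .var x => {⟨_, x⟩}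
  | _, _, .lam M => {y | (⟨y.1, .s y.2⟩ : Σ C : Ty, Var _ C) ∈ M.FV}
  | _, _, .app M N => M.FV ∪ N.FV
  | _, _, .num _ => ∅
  | _, _, .op _ M N => M.FV ∪ N.FV
  | _, _, .skip => ∅
  | _, _, .seq _ M N => M.FV ∪ N.FV
  | _, _, .assign M N => M.FV ∪ N.FV
  | _, _, .deref M => M.FV
  | _, _, .whileDo M N => M.FV ∪ N.FV
  | _, _, .ifzero _ M N₁ N₂ => M.FV ∪ N₁.FV ∪ N₂.FV
  | _, _, .new _ M => {y | (⟨y.1, .s y.2⟩ : Σ C : Ty, Var _ C) ∈ M.FV}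
  | _, _, .random => ∅
  | _, _, .mkvar M N => M.FV ∪ N.FV

/-- The affine discipline: in every application, the function and its argument have no free
identifier in common. Because of weakening and exchange, these are the terms `Θ ⊢ M : A`
generated by the typing rules in which application is
`Γ ⊢ M : A ⊸ B` and `Δ ⊢ N : A` imply `Γ, Δ ⊢ M N : B` with `Γ`, `Δ` disjoint. -/
def IsAffine : {Γ : Cxt} → {A : Ty} → Term E Γ A → Prop
  | _, _, .var _ => True
  | _, _, .lam M => M.IsAffine
  | _, _, .app M N => M.IsAffine ∧ N.IsAffine ∧ Disjoint M.FV N.FV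
  | _, _, .num _ => True
  | _, _, .op _ M N => M.IsAffine ∧ N.IsAffine
  | _, _, .skip => True
  | _, _, .seq _ M N => M.IsAffine ∧ N.IsAffine
  | _, _, .assign M N => M.IsAffine ∧ N.IsAffine
  | _, _, .deref M => M.IsAffine
  | _, _, .whileDo M N => M.IsAffine ∧ N.IsAffine
  | _, _, .ifzero _ M N₁ N₂ => M.IsAffine ∧ N₁.IsAffine ∧ N₂.IsAffine
  | _, _, .new _ M => M.IsAffine
  | _, _, .random => True
  | _, _, .mkvar M N => M.IsAffine ∧ N.IsAffine

end Term

/-! ## Renaming and substitution -/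

/-- Renamings of the identifiers of `Γ` by identifiers of `Δ`. -/
def Ren (Γ Δ : Cxt) : Type := ∀ ⦃A : Ty⦄, Var Γ A → Var Δ A

/-- The renaming of no identifiers. -/
def Ren.empty {Γ : Cxt} : Ren [] Γ
  | _, x => nomatch x

def Ren.lift {Γ Δ : Cxt} {B : Ty} (ρ : Ren Γ Δ) : Ren (B :: Γ) (B :: Δ)
  | _, .z => .z
  | _, .s x => .s (ρ x)

/-- Simultaneous substitutions of terms over `Δ` for the identifiers of `Γ`. -/
def Sub (E : Type) (Γ Δ : Cxt) : Type := ∀ ⦃A : Ty⦄, Var Γ A → Term E Δ A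

namespace Term

variable {E : Type}

def rename : {Γ Δ : Cxt} → {A : Ty} → Ren Γ Δ → Term E Γ A → Term E Δ A
  | _, _, _, ρ, .var x => .var (ρ x)
  | _, _, _, ρ, .lam M => .lam (M.rename ρ.lift)
  | _, _, _, ρ, .app M N => .app (M.rename ρ) (N.rename ρ)
  | _, _, _, _, .num n => .num n
  | _, _, _, ρ, .op o M N => .op o (M.rename ρ) (N.rename ρ)
  | _, _, _, _, .skip => .skip
  | _, _, _, ρ, .seq hB M N => .seq hB (M.rename ρ) (N.rename ρ)
  | _, _, _, ρ, .assign M N => .assign (M.rename ρ) (N.rename ρ)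
  | _, _, _, ρ, .deref M => .deref (M.rename ρ)
  | _, _, _, ρ, .whileDo M N => .whileDo (M.rename ρ) (N.rename ρ)
  | _, _, _, ρ, .ifzero hB M N₁ N₂ => .ifzero hB (M.rename ρ) (N₁.rename ρ) (N₂.rename ρ)
  | _, _, _, ρ, .new hB M => .new hB (M.rename ρ.lift)
  | _, _, _, _, .random => .random
  | _, _, _, ρ, .mkvar M N => .mkvar (M.rename ρ) (N.rename ρ)

/-- Weakening by one fresh identifier. -/
def weaken {Γ : Cxt} {A B : Ty} (M : Term E Γ A) : Term E (B :: Γ) A :=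
  M.rename (fun _ x => .s x)

/-- A closed term, seen as a term over any context. -/
def ofClosed {Γ : Cxt} {A : Ty} (M : Term E [] A) : Term E Γ A :=
  M.rename Ren.empty

end Term

def Sub.lift {E : Type} {Γ Δ : Cxt} {B : Ty} (θ : Sub E Γ Δ) : Sub E (B :: Γ) (B :: Δ)
  | _, .z => .var .z
  | _, .s x => (θ x).weaken

/-- The substitution of `N` for the most recent identifier, leaving the others unchanged. -/
def Sub.one {E : Type} {Γ : Cxt} {B : Ty} (N : Term E Γ B) : Sub E (B :: Γ) Γ
  | _, .z => N
  | _, .s x => .var x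

namespace Term

variable {E : Type}

def subst : {Γ Δ : Cxt} → {A : Ty} → Sub E Γ Δ → Term E Γ A → Term E Δ A
  | _, _, _, θ, .var x => θ x
  | _, _, _, θ, .lam M => .lam (M.subst θ.lift)
  | _, _, _, θ, .app M N => .app (M.subst θ) (N.subst θ)
  | _, _, _, _, .num n => .num n
  | _, _, _, θ, .op o M N => .op o (M.subst θ) (N.subst θ)
  | _, _, _, _, .skip => .skip
  | _, _, _, θ, .seq hB M N => .seq hB (M.subst θ) (N.subst θ)
  | _, _, _, θ, .assign M N => .assign (M.subst θ) (N.subst θ)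
  | _, _, _, θ, .deref M => .deref (M.subst θ)
  | _, _, _, θ, .whileDo M N => .whileDo (M.subst θ) (N.subst θ)
  | _, _, _, θ, .ifzero hB M N₁ N₂ => .ifzero hB (M.subst θ) (N₁.subst θ) (N₂.subst θ)
  | _, _, _, θ, .new hB M => .new hB (M.subst θ.lift)
  | _, _, _, _, .random => .random
  | _, _, _, θ, .mkvar M N => .mkvar (M.subst θ) (N.subst θ)

/-- `M[N/x]`, where `x` is the most recent identifier. -/
def inst {Γ : Cxt} {A B : Ty} (M : Term E (B :: Γ) A) (N : Term E Γ B) : Term E Γ A :=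
  M.subst (Sub.one N)

/-- Values: numerals, `skip`, identifiers of type `var`, abstractions, and `mkvar` terms. -/
inductive IsValue : {Γ : Cxt} → {A : Ty} → Term E Γ A → Prop where
  | num {Γ : Cxt} (n : ℕ) : IsValue (.num n : Term E Γ .nat)
  | skip {Γ : Cxt} : IsValue (.skip : Term E Γ .comm)
  | ident {Γ : Cxt} (x : Var Γ .var) : IsValue (.var x : Term E Γ .var)
  | lam {Γ : Cxt} {A B : Ty} (M : Term E (A :: Γ) B) : IsValue (.lam M)
  | mkvar {Γ : Cxt} (M : Term E Γ (.fn .nat .comm)) (N : Term E Γ .nat) : IsValue (.mkvar M N)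

end Term

/-! ## Operational semantics -/

/-- Stores over `Γ`: a number for each identifier of type `var`. -/
def Store (Γ : Cxt) : Type := Var Γ .var → ℕ

/-- The store over no identifiers. -/
def Store.empty : Store [] := fun x => nomatch x

/-- The store over `Γ, x : var` sending `x` to `n` and agreeing with `σ` elsewhere. -/
def Store.push {Γ : Cxt} (n : ℕ) (σ : Store Γ) : Store (.var :: Γ)
  | .z => n
  | .s x => σ x

/-- The store sending `x` to `n` and agreeing with `σ` elsewhere. -/
def Store.set {Γ : Cxt} (σ : Store Γ) (x : Var Γ .var) (n : ℕ) : Store Γ :=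
  fun y => if y = x then n else σ y

/-- `Eval δ σ M σ' V` is the judgment `Γ ⊢ σ, M ⇓ σ', V : A`. It is meant for contexts `Γ` of
identifiers of type `var`, the only ones that occur in a derivation about a closed term. -/
inductive Eval {E : Type} (δ : E → ℕ → ℕ → ℕ) :
    {Γ : Cxt} → {A : Ty} → Store Γ → Term E Γ A → Store Γ → Term E Γ A → Prop where
  | value {Γ : Cxt} {A : Ty} {σ : Store Γ} {V : Term E Γ A} (hV : V.IsValue) : Eval δ σ V σ V
  | app {Γ : Cxt} {A B : Ty} {σ σ' σ'' : Store Γ} {M : Term E Γ (.fn A B)} {N : Term E Γ A}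
      {M' : Term E (A :: Γ) B} {V : Term E Γ B} :
      Eval δ σ M σ' (.lam M') → Eval δ σ' (M'.inst N) σ'' V → Eval δ σ (.app M N) σ'' V
  | op {Γ : Cxt} {σ σ' σ'' : Store Γ} {M₁ M₂ : Term E Γ .nat} {n₁ n₂ : ℕ} (o : Op E) :
      Eval δ σ M₁ σ' (.num n₁) → Eval δ σ' M₂ σ'' (.num n₂) →
      Eval δ σ (.op o M₁ M₂) σ'' (.num (o.eval δ n₁ n₂))
  | assign {Γ : Cxt} {σ σ' σ'' : Store Γ} {M : Term E Γ .var} {N : Term E Γ .nat} {n : ℕ}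
      {x : Var Γ .var} :
      Eval δ σ N σ' (.num n) → Eval δ σ' M σ'' (.var x) →
      Eval δ σ (.assign M N) (σ''.set x n) .skip
  | deref {Γ : Cxt} {σ σ' : Store Γ} {M : Term E Γ .var} {x : Var Γ .var} :
      Eval δ σ M σ' (.var x) → Eval δ σ (.deref M) σ' (.num (σ' x))
  | seq {Γ : Cxt} {B : Ty} {σ σ' σ'' : Store Γ} {hB : B.IsBase} {M : Term E Γ .comm}
      {N V : Term E Γ B} :
      Eval δ σ M σ' .skip → Eval δ σ' N σ'' V → Eval δ σ (.seq hB M N) σ'' V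
  | while_exit {Γ : Cxt} {σ σ' : Store Γ} {M : Term E Γ .nat} {N : Term E Γ .comm} {n : ℕ}
      (hn : n ≠ 0) :
      Eval δ σ M σ' (.num n) → Eval δ σ (.whileDo M N) σ' .skip
  | while_step {Γ : Cxt} {σ σ' σ'' σ''' : Store Γ} {M : Term E Γ .nat} {N : Term E Γ .comm} :
      Eval δ σ M σ' (.num 0) → Eval δ σ' N σ'' .skip → Eval δ σ'' (.whileDo M N) σ''' .skip →
      Eval δ σ (.whileDo M N) σ''' .skip
  | ifzero_zero {Γ : Cxt} {B : Ty} {σ σ' σ'' : Store Γ} {hB : B.IsBase} {M : Term E Γ .nat}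
      {N₁ N₂ V : Term E Γ B} :
      Eval δ σ M σ' (.num 0) → Eval δ σ' N₁ σ'' V → Eval δ σ (.ifzero hB M N₁ N₂) σ'' V
  | ifzero_ne {Γ : Cxt} {B : Ty} {σ σ' σ'' : Store Γ} {hB : B.IsBase} {M : Term E Γ .nat}
      {N₁ N₂ V : Term E Γ B} {n : ℕ} (hn : n ≠ 0) :
      Eval δ σ M σ' (.num n) → Eval δ σ' N₂ σ'' V → Eval δ σ (.ifzero hB M N₁ N₂) σ'' V
  | new {Γ : Cxt} {B : Ty} {σ σ' : Store Γ} {n : ℕ} {hB : B.IsGround}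
      {M : Term E (.var :: Γ) B} {V : Term E Γ B} :
      Eval δ (σ.push 0) M (σ'.push n) V.weaken → Eval δ σ (.new hB M) σ' V
  | random {Γ : Cxt} {σ : Store Γ} (n : ℕ) : Eval δ σ .random σ (.num n)
  | assign_mkvar {Γ : Cxt} {σ σ' σ'' σ''' : Store Γ} {M : Term E Γ .var} {N : Term E Γ .nat}
      {n : ℕ} {M₁ : Term E Γ (.fn .nat .comm)} {M₂ : Term E Γ .nat} {V : Term E Γ .comm} :
      Eval δ σ N σ' (.num n) → Eval δ σ' M σ'' (.mkvar M₁ M₂) →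
      Eval δ σ'' (.app M₁ (.num n)) σ''' V → Eval δ σ (.assign M N) σ''' V
  | deref_mkvar {Γ : Cxt} {σ σ' σ'' : Store Γ} {M : Term E Γ .var}
      {M₁ : Term E Γ (.fn .nat .comm)} {M₂ V : Term E Γ .nat} :
      Eval δ σ M σ' (.mkvar M₁ M₂) → Eval δ σ' M₂ σ'' V → Eval δ σ (.deref M) σ'' V

/-- `M ⇓ V` for closed `M`, `V`. -/
def Converges {E : Type} (δ : E → ℕ → ℕ → ℕ) {A : Ty} (M V : Term E [] A) : Prop :=
  Eval δ Store.empty M Store.empty V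

/-! ## Contextual equivalence -/

/-- `Hole E A Γ B`: contexts `Γ ⊢ C[-] : B` of the language with one hole, to be filled by a closed
term of type `A`. -/
inductive Hole (E : Type) (A : Ty) : Cxt → Ty → Type where
  | hole {Γ : Cxt} : Hole E A Γ A
  | lam {Γ : Cxt} {B₁ B₂ : Ty} (C : Hole E A (B₁ :: Γ) B₂) : Hole E A Γ (.fn B₁ B₂)
  | app_fun {Γ : Cxt} {B₁ B₂ : Ty} (C : Hole E A Γ (.fn B₁ B₂)) (N : Term E Γ B₁) : Hole E A Γ B₂
  | app_arg {Γ : Cxt} {B₁ B₂ : Ty} (M : Term E Γ (.fn B₁ B₂)) (C : Hole E A Γ B₁) : Hole E A Γ B₂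
  | op_left {Γ : Cxt} (o : Op E) (C : Hole E A Γ .nat) (N : Term E Γ .nat) : Hole E A Γ .nat
  | op_right {Γ : Cxt} (o : Op E) (M : Term E Γ .nat) (C : Hole E A Γ .nat) : Hole E A Γ .nat
  | seq_left {Γ : Cxt} {B : Ty} (hB : B.IsBase) (C : Hole E A Γ .comm) (N : Term E Γ B) :
      Hole E A Γ B
  | seq_right {Γ : Cxt} {B : Ty} (hB : B.IsBase) (M : Term E Γ .comm) (C : Hole E A Γ B) :
      Hole E A Γ B
  | assign_left {Γ : Cxt} (C : Hole E A Γ .var) (N : Term E Γ .nat) : Hole E A Γ .comm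
  | assign_right {Γ : Cxt} (M : Term E Γ .var) (C : Hole E A Γ .nat) : Hole E A Γ .comm
  | deref {Γ : Cxt} (C : Hole E A Γ .var) : Hole E A Γ .nat
  | while_guard {Γ : Cxt} (C : Hole E A Γ .nat) (N : Term E Γ .comm) : Hole E A Γ .comm
  | while_body {Γ : Cxt} (M : Term E Γ .nat) (C : Hole E A Γ .comm) : Hole E A Γ .comm
  | ifzero_guard {Γ : Cxt} {B : Ty} (hB : B.IsBase) (C : Hole E A Γ .nat) (N₁ N₂ : Term E Γ B) :
      Hole E A Γ B
  | ifzero_then {Γ : Cxt} {B : Ty} (hB : B.IsBase) (M : Term E Γ .nat) (C : Hole E A Γ B)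
      (N₂ : Term E Γ B) : Hole E A Γ B
  | ifzero_else {Γ : Cxt} {B : Ty} (hB : B.IsBase) (M : Term E Γ .nat) (N₁ : Term E Γ B)
      (C : Hole E A Γ B) : Hole E A Γ B
  | new {Γ : Cxt} {B : Ty} (hB : B.IsGround) (C : Hole E A (.var :: Γ) B) : Hole E A Γ B
  | mkvar_left {Γ : Cxt} (C : Hole E A Γ (.fn .nat .comm)) (N : Term E Γ .nat) : Hole E A Γ .var
  | mkvar_right {Γ : Cxt} (M : Term E Γ (.fn .nat .comm)) (C : Hole E A Γ .nat) : Hole E A Γ .var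

/-- `C[P]`, for `P` closed. -/
def Hole.fill {E : Type} {A : Ty} (P : Term E [] A) : {Γ : Cxt} → {B : Ty} → Hole E A Γ B →
    Term E Γ B
  | _, _, .hole => P.ofClosed
  | _, _, .lam C => .lam (C.fill P)
  | _, _, .app_fun C N => .app (C.fill P) N
  | _, _, .app_arg M C => .app M (C.fill P)
  | _, _, .op_left o C N => .op o (C.fill P) N
  | _, _, .op_right o M C => .op o M (C.fill P)
  | _, _, .seq_left hB C N => .seq hB (C.fill P) N
  | _, _, .seq_right hB M C => .seq hB M (C.fill P)
  | _, _, .assign_left C N => .assign (C.fill P) N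
  | _, _, .assign_right M C => .assign M (C.fill P)
  | _, _, .deref C => .deref (C.fill P)
  | _, _, .while_guard C N => .whileDo (C.fill P) N
  | _, _, .while_body M C => .whileDo M (C.fill P)
  | _, _, .ifzero_guard hB C N₁ N₂ => .ifzero hB (C.fill P) N₁ N₂
  | _, _, .ifzero_then hB M C N₂ => .ifzero hB M (C.fill P) N₂
  | _, _, .ifzero_else hB M N₁ C => .ifzero hB M N₁ (C.fill P)
  | _, _, .new hB C => .new hB (C.fill P)
  | _, _, .mkvar_left C N => .mkvar (C.fill P) N
  | _, _, .mkvar_right M C => .mkvar M (C.fill P)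

/-- Contextual equivalence of closed terms: no well-typed closed context of type `nat` or `comm`
distinguishes them by a value that it may produce. -/
def CtxEquiv {E : Type} (δ : E → ℕ → ℕ → ℕ) {A : Ty} (M N : Term E [] A) : Prop :=
  ∀ (B : Ty), B.IsGround → ∀ C : Hole E A [] B, (C.fill M).IsAffine → (C.fill N).IsAffine →
    ∀ V : Term E [] B, V.IsValue → (Converges δ (C.fill M) V ↔ Converges δ (C.fill N) V)

/-! ## Denotational semantics -/

/-- Events of type `var`. -/
inductive VarEv where
  | read : ℕ → VarEv
  | write : ℕ → VarEv

/-- The set of observable events of a type, the alphabet of its free monoid. -/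
def Ev : Ty → Type
  | .nat => ℕ
  | .comm => Unit
  | .var => VarEv
  | .fn A B => FreeMonoid (Ev A) × Ev B

/-- The event of producing the number `n`. -/
abbrev Ev.num (n : ℕ) : Ev .nat := n

/-- The event of terminating. -/
abbrev Ev.done : Ev .comm := ()

/-- The event of reading `n`. -/
abbrev Ev.read (n : ℕ) : Ev .var := VarEv.read n

/-- The event of writing `n`. -/
abbrev Ev.write (n : ℕ) : Ev .var := VarEv.write n

/-- The event `(w, b)` of a function type. -/
abbrev Ev.fn {A B : Ty} (w : FreeMonoid (Ev A)) (b : Ev B) : Ev (.fn A B) := (w, b)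

/-- The monoid `(Ev A₁)* × ⋯ × (Ev Aₙ)*` interpreting the context `x₁ : A₁, …, xₙ : Aₙ`; the
multiplication is componentwise concatenation. -/
abbrev Env (Γ : Cxt) : Type := ∀ A : Ty, Var Γ A → FreeMonoid (Ev A)

def Env.cons {Γ : Cxt} {A : Ty} (w : FreeMonoid (Ev A)) (s : Env Γ) : Env (A :: Γ)
  | _, .z => w
  | _, .s x => s _ x

/-- The tuple with `w` at `x` and the empty sequence elsewhere. -/
def Env.single : {Γ : Cxt} → {A : Ty} → Var Γ A → FreeMonoid (Ev A) → Env Γ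
  | _, _, .z, w => Env.cons w 1
  | _, _, .s x, w => Env.cons 1 (Env.single x w)

/-- `Trans n s n'`: a memory cell holding `n` can perform the sequence `s` and then holds `n'`. -/
inductive Trans : ℕ → List VarEv → ℕ → Prop where
  | nil (n : ℕ) : Trans n [] n
  | read {n n' : ℕ} {s : List VarEv} : Trans n s n' → Trans n (.read n :: s) n'
  | write {n m n' : ℕ} {s : List VarEv} : Trans m s n' → Trans n (.write m :: s) n'

/-- Every `read` carries the value of the most recent `write`, or zero if there is none. -/
def IsCellTrace (s : FreeMonoid (Ev .var)) : Prop := ∃ n, Trans 0 (FreeMonoid.toList s) n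

/-- Denotation of a numeral. -/
def denNum {Γ : Cxt} (n : ℕ) : Set (Env Γ × Ev .nat) := {p | p.1 = 1 ∧ p.2 = Ev.num n}

/-- Application: the tuples `(s t¹ ⋯ tᵏ, b)` with `(s, (a₁ ⋯ aₖ, b))` in the function and all
`(tⁱ, aᵢ)` in the argument. Here all tuples range over the whole context; where the function and
the argument have no common identifier, `s` and the `tⁱ` have disjoint supports. -/
def denApp {Γ : Cxt} {A B : Ty} (X : Set (Env Γ × Ev (.fn A B))) (Y : Set (Env Γ × Ev A)) :
    Set (Env Γ × Ev B) :=
  {p | ∃ (s : Env Γ) (l : List (Env Γ × Ev A)), (∀ q ∈ l, q ∈ Y) ∧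
    (s, Ev.fn (FreeMonoid.ofList (l.map Prod.snd)) p.2) ∈ X ∧
    p.1 = s * (l.map Prod.fst).prod}

/-- The set of tuples `(s₁, …, sₙ, b)` denoted by a term. -/
def den {E : Type} (δ : E → ℕ → ℕ → ℕ) : {Γ : Cxt} → {A : Ty} → Term E Γ A → Set (Env Γ × Ev A)
  | _, _, .var x => {p | p.1 = Env.single x (FreeMonoid.of p.2)}
  | _, _, .lam M => {p | ∃ w b, p.2 = Ev.fn w b ∧ (Env.cons w p.1, b) ∈ den δ M}
  | _, _, .app M N => denApp (den δ M) (den δ N)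
  | _, _, .num n => denNum n
  | _, _, .op o M N =>
      {p | ∃ (s s' : Env _) (m n : ℕ), (s, Ev.num m) ∈ den δ M ∧ (s', Ev.num n) ∈ den δ N ∧
        p.1 = s * s' ∧ p.2 = Ev.num (o.eval δ m n)}
  | _, _, .skip => {p | p.1 = 1}
  | _, _, .seq _ M N =>
      {p | ∃ s s' : Env _, (s, Ev.done) ∈ den δ M ∧ (s', p.2) ∈ den δ N ∧ p.1 = s * s'}
  | _, _, .assign M N =>
      {p | ∃ (s s' : Env _) (n : ℕ), (s, Ev.num n) ∈ den δ N ∧ (s', Ev.write n) ∈ den δ M ∧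
        p.1 = s * s'}
  | _, _, .deref M => {p | ∃ n : ℕ, p.2 = Ev.num n ∧ (p.1, Ev.read n) ∈ den δ M}
  | _, _, .whileDo M N =>
      {p | ∃ (l : List (Env _ × Env _)) (s : Env _) (m : ℕ),
        (∀ q ∈ l, (q.1, Ev.num 0) ∈ den δ M ∧ (q.2, Ev.done) ∈ den δ N) ∧
        m ≠ 0 ∧ (s, Ev.num m) ∈ den δ M ∧ p.1 = (l.map (fun q => q.1 * q.2)).prod * s}
  | _, _, .ifzero _ M N₁ N₂ =>
      {p | ∃ s t : Env _, (s, Ev.num 0) ∈ den δ M ∧ (t, p.2) ∈ den δ N₁ ∧ p.1 = s * t} ∪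
      {p | ∃ (s t : Env _) (m : ℕ), m ≠ 0 ∧ (s, Ev.num m) ∈ den δ M ∧ (t, p.2) ∈ den δ N₂ ∧
        p.1 = s * t}
  | _, _, .new _ M =>
      {p | ∃ w : FreeMonoid (Ev .var), IsCellTrace w ∧ (Env.cons w p.1, p.2) ∈ den δ M}
  | _, _, .random => {p | p.1 = 1}
  | _, _, .mkvar M N =>
      {p | ∃ n : ℕ, p.2 = Ev.write n ∧ (p.1, Ev.done) ∈ denApp (den δ M) (denNum n)} ∪
      {p | ∃ n : ℕ, p.2 = Ev.read n ∧ (p.1, Ev.num n) ∈ den δ N}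

/-- The object of `MonRel` interpreting a type: the free monoid on its events. -/
def tyObj (A : Ty) : MonRel := MonRel.of (FreeMonoid (Ev A))

/-- The object of `MonRel` interpreting a context: the tensor product, that is, the product monoid,
of the objects interpreting its types. -/
def cxtObj (Γ : Cxt) : MonRel := MonRel.of (Env Γ)

/-- The denotation of a term `Γ ⊢ M : A` in `MonRel`. -/
def sem {E : Type} (δ : E → ℕ → ℕ → ℕ) {Γ : Cxt} {A : Ty} (M : Term E Γ A) :
    cxtObj Γ ⟶ tyObj A :=
  MonRel.ofPairs (A := cxtObj Γ) (den δ M)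

end SCI

/-!
The theorem follows from soundness, adequacy and definability for affine terms.

*Soundness* (`Eval.sound`): an evaluation `σ, M ⇓ σ', V` performs, on every cell of the store, a
sequence of reads and writes that leads from `σ` to `σ'`, and prefixing these sequences to the
denotation of `V` gives elements of the denotation of `M`. In the case of an application the
function and its argument have no common identifiers, so that their events commute as elements of
the product of free monoids, and the denotation of a redex `(λx.M) N` is that of `M[N/x]`
(`sden_beta`, a special case of the substitution lemma `sden_subst`).

*Adequacy* (`adequateBelow`): if `M` has an event in an environment that the store can perform,
then `M` evaluates to a value that has this event in what remains of the environment. No logical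
relation is needed, since the model records every use of an argument separately: as for
non-idempotent intersection types, an element of the denotation has a size, and contracting a redex
makes it smaller. The sized denotation `sden` keeps track of this, and adequacy is proved by
induction on the size.

Soundness and adequacy show that a closed term of type `nat` or `comm` converges to a value just
when the corresponding event is in its denotation. As the denotation is compositional, terms with
the same denotation are contextually equivalent.

*Definability* (`exists_tests_and_defines`): for each event `a` there is a closed term `T` of type
`A ⊸ comm` that terminates just when its argument is used to produce `a` once, so that `T M`
converges if and only if `a` is an event of `M`. Contextually equivalent terms therefore have the
same events. The converse notion, a closed term that denotes `a` alone, is constructed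
simultaneously, by induction on the type. For an event `(a₁ ⋯ aₖ, b)` of a function type, the
function is applied to an argument that makes an erratic choice among the events `aᵢ`, and this
argument checks and increases a local counter in order that exactly the sequence `a₁ ⋯ aₖ` be
used.
-/

namespace SCI

/-! ### Environments -/

section Environments

variable {Γ Δ : Cxt} {A B : Ty}

/-- The environment over `Γ` underlying one over `Γ, x : A`. -/
def Env.tail (s : Env (A :: Γ)) : Env Γ := fun _ x => s _ (.s x)

@[simp]
theorem Env.tail_cons (w : FreeMonoid (Ev A)) (s : Env Γ) : (Env.cons w s).tail = s := rfl

theorem Env.cons_tail (s : Env (A :: Γ)) : Env.cons (s _ .z) s.tail = s := by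
  funext B x
  cases x <;> rfl

@[simp]
theorem Env.cons_one : Env.cons (1 : FreeMonoid (Ev A)) (1 : Env Γ) = 1 := by
  funext B x
  cases x <;> rfl

theorem Env.cons_mul (w v : FreeMonoid (Ev A)) (s t : Env Γ) :
    Env.cons w s * Env.cons v t = Env.cons (w * v) (s * t) := by
  funext B x
  cases x <;> rfl

theorem Env.cons_inj {w v : FreeMonoid (Ev A)} {s t : Env Γ} :
    Env.cons w s = Env.cons v t ↔ w = v ∧ s = t := by
  constructor
  · intro h
    exact ⟨congrFun (congrFun h _) .z, congrArg Env.tail h⟩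
  · rintro ⟨rfl, rfl⟩
    rfl

@[simp]
theorem Env.single_z (w : FreeMonoid (Ev A)) :
    Env.single (.z : Var (A :: Γ) A) w = Env.cons w 1 := rfl

@[simp]
theorem Env.single_s (x : Var Γ A) (w : FreeMonoid (Ev A)) :
    Env.single (.s x : Var (B :: Γ) A) w = Env.cons 1 (Env.single x w) := rfl

@[simp]
theorem Env.single_self (x : Var Γ A) (w : FreeMonoid (Ev A)) : Env.single x w A x = w := by
  induction x with
  | z => rfl
  | s x ih => exact ih w

theorem Env.single_of_ne (x : Var Γ A) (w : FreeMonoid (Ev A)) (y : Var Γ B)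
    (h : (⟨B, y⟩ : Σ C : Ty, Var Γ C) ≠ ⟨A, x⟩) : Env.single x w B y = 1 := by
  induction x with
  | z =>
    cases y with
    | z => exact absurd rfl h
    | s y => rfl
  | s x ih =>
    cases y with
    | z => rfl
    | s y =>
      refine ih w y fun e => h ?_
      cases e
      rfl

theorem Env.eq_one (s : Env []) : s = 1 := by
  funext A x
  nomatch x

end Environments

/-! ### Monoid homomorphisms into sets -/

section Extend

variable {X Y : Type} [Monoid X] [Monoid Y]

/-- The extension of a homomorphism `R : X →* Set Y` to sets of elements of `X`. -/
def extend (R : X →* Set Y) : Set X →* Set Y where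
  toFun S := ⋃ x ∈ S, R x
  map_one' := by
    rw [← Set.singleton_one, Set.biUnion_singleton, map_one]
  map_mul' S T := by
    ext y
    simp only [Set.mem_iUnion, Set.mem_mul, exists_prop]
    constructor
    · rintro ⟨_, ⟨a, ha, b, hb, rfl⟩, hy⟩
      rw [map_mul] at hy
      obtain ⟨u, hu, v, hv, rfl⟩ := hy
      exact ⟨u, ⟨a, ha, hu⟩, v, ⟨b, hb, hv⟩, rfl⟩
    · rintro ⟨u, ⟨a, ha, hu⟩, v, ⟨b, hb, hv⟩, rfl⟩
      refine ⟨_, ⟨a, ha, b, hb, rfl⟩, ?_⟩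
      rw [map_mul]
      exact Set.mul_mem_mul hu hv

theorem mem_extend {R : X →* Set Y} {S : Set X} {y : Y} :
    y ∈ extend R S ↔ ∃ x ∈ S, y ∈ R x := by
  simp [extend]

@[simp]
theorem extend_singleton (R : X →* Set Y) (x : X) : extend R {x} = R x := by
  ext
  simp [mem_extend]

theorem extend_iUnion (R : X →* Set Y) {ι : Sort*} (S : ι → Set X) :
    extend R (⋃ i, S i) = ⋃ i, extend R (S i) := by
  ext y
  simp only [mem_extend, Set.mem_iUnion]
  constructor
  · rintro ⟨x, ⟨i, hx⟩, hy⟩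
    exact ⟨i, x, hx, hy⟩
  · rintro ⟨i, x, hx, hy⟩
    exact ⟨x, ⟨i, hx⟩, hy⟩

theorem extend_union (R : X →* Set Y) (S T : Set X) :
    extend R (S ∪ T) = extend R S ∪ extend R T := by
  ext y
  simp only [mem_extend, Set.mem_union]
  constructor
  · rintro ⟨x, hx | hx, hy⟩
    exacts [.inl ⟨x, hx, hy⟩, .inr ⟨x, hx, hy⟩]
  · rintro (⟨x, hx, hy⟩ | ⟨x, hx, hy⟩)
    exacts [⟨x, .inl hx, hy⟩, ⟨x, .inr hx, hy⟩]

theorem extend_lift (R : X →* Set Y) {α : Type} (f : α → Set X) (w : FreeMonoid α) :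
    extend R (FreeMonoid.lift f w) = FreeMonoid.lift (fun a => extend R (f a)) w :=
  FreeMonoid.hom_map_lift (extend R) f w

theorem extend_ofHom (e : X →* Y) (S : Set X) :
    extend (Set.singletonMonoidHom.comp e) S = e '' S := by
  ext y
  simp only [mem_extend, Set.mem_image]
  exact ⟨fun ⟨x, hx, hy⟩ => ⟨x, hx, (Set.mem_singleton_iff.1 hy).symm⟩,
    fun ⟨x, hx, hy⟩ => ⟨x, hx, Set.mem_singleton_iff.2 hy.symm⟩⟩

end Extend

/-! ### The sized denotation -/

/-- Environments with a size. Sizes are written multiplicatively, so that concatenation of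
environments and addition of sizes make up a single monoid. -/
abbrev SEnv (Γ : Cxt) : Type := Env Γ × Multiplicative ℕ

/-- The empty environment with size one. -/
def tick {Γ : Cxt} : SEnv Γ := (1, Multiplicative.ofAdd 1)

/-- `Env.cons`, keeping the size. -/
def SEnv.cons {Γ : Cxt} {A : Ty} (w : FreeMonoid (Ev A)) (p : SEnv Γ) : SEnv (A :: Γ) :=
  (Env.cons w p.1, p.2)

/-- `Env.tail`, keeping the size. -/
def SEnv.tail {Γ : Cxt} {A : Ty} (p : SEnv (A :: Γ)) : SEnv Γ := (p.1.tail, p.2)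

/-- The denotation of a term as a family of sets of environments indexed by events, each
environment carrying the number of constructs of the term other than identifiers and values that
are passed through on the way to the event. Each iteration of a loop counts once more, so that it
pays for unfolding the loop, and a write to `mkvar M N` counts as the application of `M` that it
performs. Projecting the sizes away recovers `den`, see `mem_den_iff`. -/
def sden {E : Type} (δ : E → ℕ → ℕ → ℕ) :
    {Γ : Cxt} → {A : Ty} → Term E Γ A → Ev A → Set (SEnv Γ)
  | _, _, .var x, a => {(Env.single x (FreeMonoid.of a), 1)}
  | _, _, .lam M, b => {p | SEnv.cons b.1 p ∈ sden δ M b.2}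
  | _, _, .app M N, b => {tick} * ⋃ w, sden δ M (Ev.fn w b) * FreeMonoid.lift (sden δ N) w
  | _, _, .num n, m => ⋃ _ : m = Ev.num n, 1
  | _, _, .op o M N, k =>
      {tick} * ⋃ (m : ℕ) (n : ℕ) (_ : k = Ev.num (o.eval δ m n)),
        sden δ M (Ev.num m) * sden δ N (Ev.num n)
  | _, _, .skip, _ => 1
  | _, _, .seq _ M N, b => {tick} * (sden δ M Ev.done * sden δ N b)
  | _, _, .assign M N, _ => {tick} * ⋃ n : ℕ, sden δ N (Ev.num n) * sden δ M (Ev.write n)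
  | _, _, .deref M, n => {tick} * sden δ M (Ev.read n)
  | _, _, .whileDo M N, _ =>
      {tick} * ⋃ (j : ℕ) (m : ℕ) (_ : m ≠ 0),
        ({tick} * (sden δ M (Ev.num 0) * sden δ N Ev.done)) ^ j * sden δ M (Ev.num m)
  | _, _, .ifzero _ M N₁ N₂, b =>
      {tick} * (sden δ M (Ev.num 0) * sden δ N₁ b ∪
        ⋃ (m : ℕ) (_ : m ≠ 0), sden δ M (Ev.num m) * sden δ N₂ b)
  | _, _, .new _ M, b =>
      {tick} * ⋃ (w : FreeMonoid (Ev .var)) (_ : IsCellTrace w), {p | SEnv.cons w p ∈ sden δ M b}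
  | _, _, .random, _ => 1
  | _, _, .mkvar M N, b =>
      (⋃ (n : ℕ) (_ : b = Ev.write n),
        {tick} * ⋃ w, sden δ M (Ev.fn w Ev.done) *
          FreeMonoid.lift (fun m => ⋃ _ : m = Ev.num n, 1) w) ∪
      ⋃ (n : ℕ) (_ : b = Ev.read n), sden δ N (Ev.num n)

variable {E : Type} {Γ Δ : Cxt} {A B : Ty}

theorem SEnv.cons_mul (w v : FreeMonoid (Ev A)) (p q : SEnv Γ) :
    SEnv.cons w p * SEnv.cons v q = SEnv.cons (w * v) (p * q) :=
  Prod.ext (Env.cons_mul _ _ _ _) rfl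

theorem SEnv.cons_inj {w v : FreeMonoid (Ev A)} {p q : SEnv Γ} :
    SEnv.cons w p = SEnv.cons v q ↔ w = v ∧ p = q := by
  simp [SEnv.cons, Prod.ext_iff, Env.cons_inj, and_assoc]

@[simp]
theorem SEnv.tail_mul (p q : SEnv (A :: Γ)) : (p * q).tail = p.tail * q.tail := rfl

@[simp]
theorem SEnv.tail_one : (1 : SEnv (A :: Γ)).tail = 1 := rfl

@[simp]
theorem SEnv.tail_tick : (tick : SEnv (A :: Γ)).tail = tick := rfl

theorem SEnv.cons_one : SEnv.cons 1 (1 : SEnv Γ) = (1 : SEnv (A :: Γ)) :=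
  Prod.ext Env.cons_one rfl

theorem SEnv.cons_tick : SEnv.cons 1 (tick : SEnv Γ) = (tick : SEnv (A :: Γ)) :=
  Prod.ext Env.cons_one rfl

theorem SEnv.cons_tail (p : SEnv (A :: Γ)) : SEnv.cons (p.1 _ .z) p.tail = p :=
  Prod.ext (Env.cons_tail _) rfl

/-- The extension of `R` that leaves one further identifier alone. -/
def liftHom (A : Ty) (R : SEnv Γ →* Set (SEnv Δ)) : SEnv (A :: Γ) →* Set (SEnv (A :: Δ)) where
  toFun p := SEnv.cons (p.1 _ .z) '' R p.tail
  map_one' := by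
    rw [SEnv.tail_one, map_one, ← Set.singleton_one, Set.image_singleton]
    exact congrArg _ SEnv.cons_one
  map_mul' p q := by
    rw [SEnv.tail_mul, map_mul]
    ext r
    simp only [Set.mem_image, Set.mem_mul]
    constructor
    · rintro ⟨_, ⟨u, hu, v, hv, rfl⟩, rfl⟩
      exact ⟨_, ⟨u, hu, rfl⟩, _, ⟨v, hv, rfl⟩, SEnv.cons_mul _ _ _ _⟩
    · rintro ⟨_, ⟨u, hu, rfl⟩, _, ⟨v, hv, rfl⟩, rfl⟩
      exact ⟨_, ⟨u, hu, v, hv, rfl⟩, (SEnv.cons_mul _ _ _ _).symm⟩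

theorem liftHom_apply (R : SEnv Γ →* Set (SEnv Δ)) (p : SEnv (A :: Γ)) :
    liftHom A R p = SEnv.cons (p.1 _ .z) '' R p.tail := rfl

theorem liftHom_tick {R : SEnv Γ →* Set (SEnv Δ)} (h : R tick = {tick}) :
    liftHom A R tick = {tick} := by
  rw [liftHom_apply, SEnv.tail_tick, h, Set.image_singleton]
  exact congrArg _ SEnv.cons_tick

theorem liftHom_z (R : SEnv Γ →* Set (SEnv Δ)) (a : Ev A) :
    liftHom A R (Env.single .z (FreeMonoid.of a), 1) = {(Env.single .z (FreeMonoid.of a), 1)} := by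
  have : R (1, 1) = {1} := map_one R
  rw [liftHom_apply]
  simp only [SEnv.tail, Env.single_z, Env.tail_cons, this, Set.image_singleton]
  rfl

theorem liftHom_s (R : SEnv Γ →* Set (SEnv Δ)) (x : Var Γ B) (a : Ev B) :
    liftHom A R (Env.single (.s x) (FreeMonoid.of a), 1) =
      SEnv.cons 1 '' R (Env.single x (FreeMonoid.of a), 1) := rfl

theorem setOf_cons_mem_extend (R : SEnv Γ →* Set (SEnv Δ)) (w : FreeMonoid (Ev A))
    (X : Set (SEnv (A :: Γ))) :
    {q | SEnv.cons w q ∈ extend (liftHom A R) X} = extend R {p | SEnv.cons w p ∈ X} := by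
  ext q
  simp only [Set.mem_ofPred_eq, mem_extend, liftHom_apply, Set.mem_image]
  constructor
  · rintro ⟨p, hp, r, hr, e⟩
    obtain ⟨rfl, rfl⟩ := SEnv.cons_inj.1 e
    exact ⟨p.tail, by rwa [SEnv.cons_tail], hr⟩
  · rintro ⟨p, hp, hq⟩
    exact ⟨_, hp, q, hq, rfl⟩

/-! ### Renaming and substitution -/

/-- Renaming of identifiers acts on sized denotations by any homomorphism that acts accordingly
on the events of the identifiers that occur free. -/
theorem sden_rename (δ : E → ℕ → ℕ → ℕ) (M : Term E Γ A) (ρ : Ren Γ Δ)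
    (R : SEnv Γ →* Set (SEnv Δ)) (hR : R tick = {tick})
    (h : ∀ (C : Ty) (x : Var Γ C), ⟨C, x⟩ ∈ M.FV → ∀ a : Ev C,
      R (Env.single x (FreeMonoid.of a), 1) = {(Env.single (ρ x) (FreeMonoid.of a), 1)})
    (b : Ev A) :
    sden δ (M.rename ρ) b = extend R (sden δ M b) := by
  induction M generalizing Δ with
  | var x => exact ((extend_singleton R _).trans (h _ x rfl b)).symm
  | num n => simp only [sden, Term.rename, extend_iUnion, map_one]
  | skip => simp only [sden, Term.rename, map_one]
  | random => simp only [sden, Term.rename, map_one]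
  | lam M ih =>
    have := ih ρ.lift (liftHom _ R) (liftHom_tick hR) (fun C x hx a => by
      cases x with
      | z => exact liftHom_z R a
      | s x => rw [liftHom_s, h C x hx a, Set.image_singleton]; rfl)
    simp only [sden, Term.rename, this, setOf_cons_mem_extend]
  | new hB M ih =>
    have := ih ρ.lift (liftHom _ R) (liftHom_tick hR) (fun C x hx a => by
      cases x with
      | z => exact liftHom_z R a
      | s x => rw [liftHom_s, h C x hx a, Set.image_singleton]; rfl)
    simp only [sden, Term.rename, this, setOf_cons_mem_extend, map_mul, extend_iUnion,
      extend_singleton, hR]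
  | deref M ihM =>
    simp only [sden, Term.rename, ihM ρ R hR h, map_mul, extend_singleton, hR]
  | ifzero hB M N₁ N₂ ihM ihN₁ ihN₂ =>
    simp only [sden, Term.rename, funext (ihM ρ R hR fun C x hx => h C x (.inl (.inl hx))),
      funext (ihN₁ ρ R hR fun C x hx => h C x (.inl (.inr hx))),
      funext (ihN₂ ρ R hR fun C x hx => h C x (.inr hx)),
      map_mul, extend_union, extend_iUnion, extend_singleton, hR]
  | _ =>
    rename_i ihM ihN
    simp only [sden, Term.rename, funext (ihM ρ R hR fun C x hx => h C x (.inl hx)),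
      funext (ihN ρ R hR fun C x hx => h C x (.inr hx)), map_mul, map_pow, map_one, extend_union,
      extend_lift, extend_iUnion, extend_singleton, hR]

theorem sden_weaken (δ : E → ℕ → ℕ → ℕ) (M : Term E Γ A) (b : Ev A) :
    sden δ (M.weaken (B := B)) b = SEnv.cons 1 '' sden δ M b := by
  let e : SEnv Γ →* SEnv (B :: Γ) :=
    { toFun := SEnv.cons 1
      map_one' := SEnv.cons_one
      map_mul' := fun p q => by rw [SEnv.cons_mul, one_mul] }
  have := sden_rename δ M (fun _ x => .s x) (Set.singletonMonoidHom.comp e)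
    (congrArg (fun p => ({p} : Set _)) SEnv.cons_tick) (fun C x _ a => rfl) b
  rw [extend_ofHom] at this
  exact this

theorem sden_ofClosed (δ : E → ℕ → ℕ → ℕ) (M : Term E [] A) (b : Ev A) :
    sden δ (M.ofClosed (Γ := Γ)) b = (fun p => (1, p.2)) '' sden δ M b := by
  let e : SEnv [] →* SEnv Γ :=
    { toFun := fun p => (1, p.2)
      map_one' := rfl
      map_mul' := fun p q => Prod.ext (mul_one 1).symm rfl }
  have := sden_rename δ M Ren.empty (Set.singletonMonoidHom.comp e) rfl (fun C x => nomatch x) b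
  rw [extend_ofHom] at this
  exact this

/-- The environments that are empty outside of `S`. -/
def supported (S : Set (Σ C, Var Γ C)) : Submonoid (Env Γ) where
  carrier := {s | ∀ (C : Ty) (x : Var Γ C), ⟨C, x⟩ ∉ S → s C x = 1}
  one_mem' := fun _ _ _ => rfl
  mul_mem' := fun {s t} hs ht C x hx => by
    rw [Pi.mul_apply, Pi.mul_apply, hs C x hx, ht C x hx]
    rfl

theorem mul_mem_supported {S : Set (Σ C, Var Γ C)} {s t : Env Γ} :
    s * t ∈ supported S ↔ s ∈ supported S ∧ t ∈ supported S := by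
  refine ⟨fun h => ⟨fun C x hx => ?_, fun C x hx => ?_⟩, fun h => mul_mem h.1 h.2⟩
  · exact (List.append_eq_nil_iff.1 (h C x hx)).1
  · exact (List.append_eq_nil_iff.1 (h C x hx)).2

open Classical in
/-- The homomorphism that discards the environments with events outside of `S`. -/
noncomputable def restrictHom (S : Set (Σ C, Var Γ C)) : SEnv Γ →* Set (SEnv Γ) where
  toFun p := if p.1 ∈ supported S then {p} else ∅
  map_one' := if_pos (one_mem (supported S))
  map_mul' p q := by
    simp only [Prod.fst_mul, mul_mem_supported]
    by_cases hp : p.1 ∈ supported S <;> by_cases hq : q.1 ∈ supported S <;> simp [hp, hq]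

theorem single_mem_supported {S : Set (Σ C, Var Γ C)} {x : Var Γ A} (hx : ⟨A, x⟩ ∈ S)
    (w : FreeMonoid (Ev A)) : Env.single x w ∈ supported S := fun _ y hy =>
  Env.single_of_ne x w y fun e => hy (e ▸ hx)

/-- Only free identifiers have events. This is naturality of `sden` under renaming: the identity
renaming is covered both by the identity homomorphism and by the one that discards all
environments not supported on the free identifiers. -/
theorem sden_supported (δ : E → ℕ → ℕ → ℕ) (M : Term E Γ A) (b : Ev A) {p : SEnv Γ}
    (hp : p ∈ sden δ M b) : p.1 ∈ supported M.FV := by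
  have h₁ := sden_rename δ M (fun _ x => x) (Set.singletonMonoidHom.comp (MonoidHom.id _)) rfl
    (fun C x _ a => rfl) b
  have h₂ := sden_rename δ M (fun _ x => x) (restrictHom M.FV) (if_pos (one_mem _))
    (fun C x hx a => if_pos (single_mem_supported hx _)) b
  rw [h₁, extend_ofHom] at h₂
  have : p ∈ extend (restrictHom M.FV) (sden δ M b) := h₂ ▸ ⟨p, hp, rfl⟩
  obtain ⟨q, -, hq⟩ := mem_extend.1 this
  by_cases h : q.1 ∈ supported M.FV
  · have e : p ∈ ({q} : Set (SEnv Γ)) := by simpa [restrictHom, h] using hq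
    rwa [Set.mem_singleton_iff.1 e]
  · simp [restrictHom, h] at hq

/-- Substitution acts on sized denotations as a composition of relations, provided that what is
substituted for the free identifiers is given by a homomorphism. -/
theorem sden_subst (δ : E → ℕ → ℕ → ℕ) (M : Term E Γ A) (θ : Sub E Γ Δ)
    (R : SEnv Γ →* Set (SEnv Δ)) (hR : R tick = {tick})
    (h : ∀ (C : Ty) (x : Var Γ C), ⟨C, x⟩ ∈ M.FV → ∀ a : Ev C,
      R (Env.single x (FreeMonoid.of a), 1) = sden δ (θ x) a) (b : Ev A) :
    sden δ (M.subst θ) b = extend R (sden δ M b) := by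
  induction M generalizing Δ with
  | var x => exact ((extend_singleton R _).trans (h _ x rfl b)).symm
  | num n => simp only [sden, Term.subst, extend_iUnion, map_one]
  | skip => simp only [sden, Term.subst, map_one]
  | random => simp only [sden, Term.subst, map_one]
  | lam M ih =>
    have := ih θ.lift (liftHom _ R) (liftHom_tick hR) (fun C x hx a => by
      cases x with
      | z => exact liftHom_z R a
      | s x => rw [liftHom_s, h C x hx a, ← sden_weaken]; rfl)
    simp only [sden, Term.subst, this, setOf_cons_mem_extend]
  | new hB M ih =>
    have := ih θ.lift (liftHom _ R) (liftHom_tick hR) (fun C x hx a => by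
      cases x with
      | z => exact liftHom_z R a
      | s x => rw [liftHom_s, h C x hx a, ← sden_weaken]; rfl)
    simp only [sden, Term.subst, this, setOf_cons_mem_extend, map_mul, extend_iUnion,
      extend_singleton, hR]
  | deref M ihM =>
    simp only [sden, Term.subst, ihM θ R hR h, map_mul, extend_singleton, hR]
  | ifzero hB M N₁ N₂ ihM ihN₁ ihN₂ =>
    simp only [sden, Term.subst, funext (ihM θ R hR fun C x hx => h C x (.inl (.inl hx))),
      funext (ihN₁ θ R hR fun C x hx => h C x (.inl (.inr hx))),
      funext (ihN₂ θ R hR fun C x hx => h C x (.inr hx)),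
      map_mul, extend_union, extend_iUnion, extend_singleton, hR]
  | _ =>
    rename_i ihM ihN
    simp only [sden, Term.subst, funext (ihM θ R hR fun C x hx => h C x (.inl hx)),
      funext (ihN θ R hR fun C x hx => h C x (.inr hx)), map_mul, map_pow, map_one, extend_union,
      extend_lift, extend_iUnion, extend_singleton, hR]

theorem commute_of_supported {S T : Set (Σ C, Var Γ C)} (hST : Disjoint S T) {s t : Env Γ}
    (hs : s ∈ supported S) (ht : t ∈ supported T) : Commute s t := by
  funext C x
  by_cases hx : (⟨C, x⟩ : Σ C : Ty, Var Γ C) ∈ S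
  · simp [ht C x (Set.disjoint_left.1 hST hx)]
  · simp [hs C x hx]

theorem lift_sden_supported (δ : E → ℕ → ℕ → ℕ) (N : Term E Γ A) (w : FreeMonoid (Ev A))
    {p : SEnv Γ} (hp : p ∈ FreeMonoid.lift (sden δ N) w) : p.1 ∈ supported N.FV := by
  induction w using FreeMonoid.inductionOn' generalizing p with
  | one =>
    rw [map_one, Set.mem_one] at hp
    rw [hp]
    exact one_mem _
  | of_mul a w ih =>
    rw [map_mul, FreeMonoid.lift_eval_of] at hp
    obtain ⟨q, hq, r, hr, rfl⟩ := hp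
    exact mul_mem (sden_supported δ N a hq) (ih hr)

/-- The action of substituting `N` for the most recent identifier, on the environments over the
remaining identifiers supported on a set that is disjoint from the free identifiers of `N`.
Disjointness is what makes this a homomorphism: the events of `N` commute with all others. -/
def substHom (δ : E → ℕ → ℕ → ℕ) (N : Term E Γ B) (S : Set (Σ C, Var Γ C))
    (hS : Disjoint S N.FV) : SEnv (B :: Γ) →* Set (SEnv Γ) where
  toFun p := {q | p.tail.1 ∈ supported S ∧
    ∃ v ∈ FreeMonoid.lift (sden δ N) (p.1 _ .z), q = p.tail * v}
  map_one' := by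
    ext q
    rw [Set.mem_one]
    refine ⟨?_, ?_⟩
    · rintro ⟨-, v, hv, rfl⟩
      rw [Prod.fst_one, Pi.one_apply, Pi.one_apply, map_one, Set.mem_one] at hv
      rw [hv]
      rfl
    · rintro rfl
      exact ⟨one_mem _, 1, by simp, rfl⟩
  map_mul' p p' := by
    ext q
    simp only [Set.mem_mul, Set.mem_ofPred_eq, Prod.fst_mul, Pi.mul_apply, map_mul]
    have key : ∀ {p' v : SEnv Γ} (w : FreeMonoid (Ev B)), p'.1 ∈ supported S →
        v ∈ FreeMonoid.lift (sden δ N) w → p' * v = v * p' := fun w h₁ h₂ =>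
      Prod.ext (commute_of_supported hS h₁ (lift_sden_supported δ N w h₂)) (mul_comm _ _)
    constructor
    · rintro ⟨hp, _, ⟨v, hv, v', hv', rfl⟩, rfl⟩
      obtain ⟨hp, hp'⟩ := mul_mem_supported.1 hp
      refine ⟨_, ⟨hp, v, hv, rfl⟩, _, ⟨hp', v', hv', rfl⟩, ?_⟩
      rw [SEnv.tail_mul, mul_assoc, mul_assoc, ← mul_assoc v, ← key _ hp' hv, mul_assoc]
    · rintro ⟨_, ⟨hp, v, hv, rfl⟩, _, ⟨hp', v', hv', rfl⟩, rfl⟩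
      refine ⟨mul_mem hp hp', _, ⟨v, hv, v', hv', rfl⟩, ?_⟩
      rw [SEnv.tail_mul, mul_assoc, mul_assoc, ← mul_assoc v, ← key _ hp' hv, mul_assoc]

theorem substHom_apply (δ : E → ℕ → ℕ → ℕ) (N : Term E Γ B) (S : Set (Σ C, Var Γ C))
    (hS : Disjoint S N.FV) {p : SEnv (B :: Γ)} (hp : p.tail.1 ∈ supported S) :
    substHom δ N S hS p = {p.tail} * FreeMonoid.lift (sden δ N) (p.1 _ .z) := by
  ext q
  rw [Set.singleton_mul]
  exact ⟨fun ⟨_, v, hv, e⟩ => ⟨v, hv, e.symm⟩, fun ⟨v, hv, e⟩ => ⟨hp, v, hv, e.symm⟩⟩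

/-- Contracting a redex of an affine term decreases sizes by one and changes nothing else. -/
theorem sden_beta (δ : E → ℕ → ℕ → ℕ) (M : Term E (B :: Γ) A) (N : Term E Γ B)
    (hMN : Disjoint (Term.lam M).FV N.FV) (b : Ev A) :
    sden δ (.app (.lam M) N) b = {tick} * sden δ (M.inst N) b := by
  have h := sden_subst δ M (Sub.one N) (substHom δ N _ hMN) ?_ ?_ b
  · simp only [sden, Term.inst, h]
    congr 1
    ext q
    simp only [Set.mem_iUnion, mem_extend]
    constructor
    · rintro ⟨w, p, hp, v, hv, rfl⟩
      refine ⟨_, hp, sden_supported δ (.lam M) (Ev.fn w b) hp, v, hv, rfl⟩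
    · rintro ⟨p, hp, -, v, hv, rfl⟩
      refine ⟨p.1 _ .z, p.tail, ?_, v, hv, rfl⟩
      change SEnv.cons (p.1 _ .z) p.tail ∈ sden δ M b
      rwa [SEnv.cons_tail]
  · rw [substHom_apply]
    · have : (tick : SEnv (B :: Γ)).1 _ .z = 1 := rfl
      rw [this, map_one, mul_one, SEnv.tail_tick]
    · exact one_mem _
  · intro C x hx a
    cases x with
    | z =>
      rw [substHom_apply]
      · have e : (Env.single (.z : Var (B :: Γ) B) (FreeMonoid.of a)) _ .z = FreeMonoid.of a := rfl
        simp only [e, FreeMonoid.lift_eval_of]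
        exact one_mul _
      · exact one_mem _
    | s x =>
      rw [substHom_apply]
      · have e : (Env.single (.s x : Var (B :: Γ) C) (FreeMonoid.of a)) _ .z = 1 := rfl
        simp only [e, map_one, mul_one]
        rfl
      · exact single_mem_supported (S := (Term.lam M).FV) hx _

/-! ### Equations for the denotation -/

/-- The environments in which a term produces a given event. -/
def obs (δ : E → ℕ → ℕ → ℕ) (M : Term E Γ A) (b : Ev A) : Set (Env Γ) := {s | (s, b) ∈ den δ M}

theorem mem_obs {δ : E → ℕ → ℕ → ℕ} {M : Term E Γ A} {b : Ev A} {s : Env Γ} :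
    s ∈ obs δ M b ↔ (s, b) ∈ den δ M := Iff.rfl

theorem mem_lift_iff_exists_list {X : Type} [Monoid X] {α : Type} (Y : Set (X × α))
    (w : FreeMonoid α) (t : X) :
    t ∈ FreeMonoid.lift (fun a => {x | (x, a) ∈ Y}) w ↔
      ∃ l : List (X × α), (∀ q ∈ l, q ∈ Y) ∧ FreeMonoid.ofList (l.map Prod.snd) = w ∧
        t = (l.map Prod.fst).prod := by
  induction w using FreeMonoid.inductionOn' generalizing t with
  | one =>
    rw [map_one, Set.mem_one]
    constructor
    · rintro rfl
      exact ⟨[], by simp, rfl, rfl⟩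
    · rintro ⟨l, -, hl, rfl⟩
      have : l = [] := by
        have h := congrArg FreeMonoid.toList hl
        simpa using h
      simp [this]
  | of_mul a w ih =>
    rw [map_mul, FreeMonoid.lift_eval_of, Set.mem_mul]
    constructor
    · rintro ⟨x, hx, y, hy, rfl⟩
      obtain ⟨l, hl, rfl, rfl⟩ := (ih y).1 hy
      exact ⟨(x, a) :: l, by simpa using ⟨hx, fun a b h => hl _ h⟩, rfl, by simp⟩
    · rintro ⟨l, hl, e, rfl⟩
      cases l with
      | nil =>
        have h := congrArg FreeMonoid.toList e
        simp at h
      | cons q l =>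
        obtain ⟨x, a'⟩ := q
        have h := congrArg FreeMonoid.toList e
        simp only [List.map_cons, FreeMonoid.toList_ofList, FreeMonoid.toList_mul,
          FreeMonoid.toList_of, List.singleton_append, List.cons.injEq] at h
        obtain ⟨rfl, h⟩ := h
        refine ⟨x, hl _ (by simp), _, (ih _).2 ⟨l, fun q hq => hl q (by simp [hq]), ?_, rfl⟩, ?_⟩
        · rw [h, FreeMonoid.ofList_toList]
        · simp

theorem mem_denApp {X : Set (Env Γ × Ev (.fn A B))} {Y : Set (Env Γ × Ev A)} {s : Env Γ}
    {b : Ev B} : (s, b) ∈ denApp X Y ↔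
      s ∈ ⋃ w, {s | (s, Ev.fn w b) ∈ X} * FreeMonoid.lift (fun a => {t | (t, a) ∈ Y}) w := by
  simp only [Set.mem_iUnion, Set.mem_mul, mem_lift_iff_exists_list]
  constructor
  · rintro ⟨u, l, hl, hu, rfl⟩
    exact ⟨_, u, hu, _, ⟨l, hl, rfl, rfl⟩, rfl⟩
  · rintro ⟨_, u, hu, _, ⟨l, hl, rfl, rfl⟩, rfl⟩
    exact ⟨u, l, hl, hu, rfl⟩

section Equations

variable (δ : E → ℕ → ℕ → ℕ)

theorem obs_var (x : Var Γ A) (a : Ev A) :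
    obs δ (.var x) a = {Env.single x (FreeMonoid.of a)} := by
  ext
  simp [mem_obs, den]

theorem obs_lam (M : Term E (A :: Γ) B) (w : FreeMonoid (Ev A)) (b : Ev B) :
    obs δ (.lam M) (Ev.fn w b) = {s | Env.cons w s ∈ obs δ M b} := by
  ext s
  simp only [mem_obs, den, Set.mem_ofPred_eq]
  constructor
  · rintro ⟨_, _, e, h⟩
    obtain ⟨rfl, rfl⟩ := Prod.ext_iff.1 e
    exact h
  · exact fun h => ⟨_, _, rfl, h⟩

theorem obs_app (M : Term E Γ (.fn A B)) (N : Term E Γ A) (b : Ev B) :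
    obs δ (.app M N) b = ⋃ w, obs δ M (Ev.fn w b) * FreeMonoid.lift (obs δ N) w := by
  ext s
  exact mem_denApp

theorem obs_num (n : ℕ) (m : Ev .nat) :
    obs δ (.num n : Term E Γ .nat) m = ⋃ _ : m = Ev.num n, 1 := by
  ext s
  simp only [mem_obs, den, denNum, Set.mem_ofPred_eq, Set.mem_iUnion, Set.mem_one, exists_prop]
  exact and_comm

theorem obs_op (o : Op E) (M N : Term E Γ .nat) (k : Ev .nat) :
    obs δ (.op o M N) k =
      ⋃ (m : ℕ) (n : ℕ) (_ : k = Ev.num (o.eval δ m n)),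
        obs δ M (Ev.num m) * obs δ N (Ev.num n) := by
  ext s
  simp only [mem_obs, den, Set.mem_ofPred_eq, Set.mem_iUnion, Set.mem_mul, exists_prop]
  constructor
  · rintro ⟨u, v, m, n, hu, hv, rfl, hk⟩
    exact ⟨m, n, hk, u, hu, v, hv, rfl⟩
  · rintro ⟨m, n, hk, u, hu, v, hv, rfl⟩
    exact ⟨u, v, m, n, hu, hv, rfl, hk⟩

theorem obs_skip (b : Ev .comm) : obs δ (.skip : Term E Γ .comm) b = 1 := rfl

theorem obs_random (b : Ev .nat) : obs δ (.random : Term E Γ .nat) b = 1 := rfl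

theorem obs_seq (hB : B.IsBase) (M : Term E Γ .comm) (N : Term E Γ B) (b : Ev B) :
    obs δ (.seq hB M N) b = obs δ M Ev.done * obs δ N b := by
  ext s
  simp only [mem_obs, den, Set.mem_ofPred_eq, Set.mem_mul]
  exact ⟨fun ⟨u, v, hu, hv, e⟩ => ⟨u, hu, v, hv, e.symm⟩,
    fun ⟨u, hu, v, hv, e⟩ => ⟨u, v, hu, hv, e.symm⟩⟩

theorem obs_assign (M : Term E Γ .var) (N : Term E Γ .nat) (b : Ev .comm) :
    obs δ (.assign M N) b = ⋃ n : ℕ, obs δ N (Ev.num n) * obs δ M (Ev.write n) := by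
  ext s
  simp only [mem_obs, den, Set.mem_ofPred_eq, Set.mem_iUnion, Set.mem_mul]
  exact ⟨fun ⟨u, v, n, hu, hv, e⟩ => ⟨n, u, hu, v, hv, e.symm⟩,
    fun ⟨n, u, hu, v, hv, e⟩ => ⟨u, v, n, hu, hv, e.symm⟩⟩

theorem obs_deref (M : Term E Γ .var) (n : ℕ) :
    obs δ (.deref M) (Ev.num n) = obs δ M (Ev.read n) := by
  ext s
  simp only [mem_obs, den, Set.mem_ofPred_eq]
  exact ⟨fun ⟨_, e, h⟩ => (show n = _ from e) ▸ h, fun h => ⟨n, rfl, h⟩⟩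

theorem obs_whileDo (M : Term E Γ .nat) (N : Term E Γ .comm) (b : Ev .comm) :
    obs δ (.whileDo M N) b =
      ⋃ (j : ℕ) (m : ℕ) (_ : m ≠ 0),
        (obs δ M (Ev.num 0) * obs δ N Ev.done) ^ j * obs δ M (Ev.num m) := by
  ext s
  simp only [mem_obs, den, Set.mem_ofPred_eq, Set.mem_iUnion, exists_prop]
  constructor
  · rintro ⟨l, u, m, hl, hm, hu, rfl⟩
    refine ⟨l.length, m, hm, Set.mul_mem_mul ?_ hu⟩
    clear hm hu
    induction l with
    | nil => exact Set.mem_one.2 rfl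
    | cons q l ih =>
      rw [List.map_cons, List.prod_cons, List.length_cons, pow_succ']
      exact Set.mul_mem_mul (Set.mul_mem_mul (hl q (by simp)).1 (hl q (by simp)).2)
        (ih fun r hr => hl r (by simp [hr]))
  · rintro ⟨j, m, hm, v, hv, u, hu, rfl⟩
    suffices ∃ l : List (Env Γ × Env Γ), (∀ q ∈ l, (q.1, Ev.num 0) ∈ den δ M ∧
        (q.2, Ev.done) ∈ den δ N) ∧ v = (l.map fun q => q.1 * q.2).prod by
      obtain ⟨l, hl, rfl⟩ := this
      exact ⟨l, u, m, hl, hm, hu, rfl⟩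
    clear hu
    induction j generalizing v with
    | zero =>
      rw [pow_zero, Set.mem_one] at hv
      exact ⟨[], by simp, hv⟩
    | succ j ih =>
      rw [pow_succ'] at hv
      obtain ⟨_, ⟨x, hx, y, hy, rfl⟩, v, hv, rfl⟩ := hv
      obtain ⟨l, hl, rfl⟩ := ih v hv
      exact ⟨(x, y) :: l, by simpa using ⟨⟨hx, hy⟩, fun a b h => hl _ h⟩, by simp⟩

theorem obs_ifzero (hB : B.IsBase) (M : Term E Γ .nat) (N₁ N₂ : Term E Γ B) (b : Ev B) :
    obs δ (.ifzero hB M N₁ N₂) b = obs δ M (Ev.num 0) * obs δ N₁ b ∪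
      ⋃ (m : ℕ) (_ : m ≠ 0), obs δ M (Ev.num m) * obs δ N₂ b := by
  ext s
  simp only [mem_obs, den, Set.mem_union, Set.mem_ofPred_eq, Set.mem_iUnion, Set.mem_mul,
    exists_prop]
  refine or_congr ⟨fun ⟨u, v, hu, hv, e⟩ => ⟨u, hu, v, hv, e.symm⟩,
    fun ⟨u, hu, v, hv, e⟩ => ⟨u, v, hu, hv, e.symm⟩⟩
    ⟨fun ⟨u, v, m, hm, hu, hv, e⟩ => ⟨m, hm, u, hu, v, hv, e.symm⟩,
    fun ⟨m, hm, u, hu, v, hv, e⟩ => ⟨u, v, m, hm, hu, hv, e.symm⟩⟩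

theorem obs_new (hB : B.IsGround) (M : Term E (.var :: Γ) B) (b : Ev B) :
    obs δ (.new hB M) b =
      ⋃ (w : FreeMonoid (Ev .var)) (_ : IsCellTrace w), {s | Env.cons w s ∈ obs δ M b} := by
  ext s
  simp only [mem_obs, den, Set.mem_ofPred_eq, Set.mem_iUnion, exists_prop]

theorem obs_mkvar (M : Term E Γ (.fn .nat .comm)) (N : Term E Γ .nat) (b : Ev .var) :
    obs δ (.mkvar M N) b =
      (⋃ (n : ℕ) (_ : b = Ev.write n), obs δ (.app M (.num n)) Ev.done) ∪
        ⋃ (n : ℕ) (_ : b = Ev.read n), obs δ N (Ev.num n) := by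
  ext s
  simp only [mem_obs, den, Set.mem_union, Set.mem_ofPred_eq, Set.mem_iUnion, exists_prop]

theorem obs_mkvar_write (M : Term E Γ (.fn .nat .comm)) (N : Term E Γ .nat) (n : ℕ) :
    obs δ (.mkvar M N) (Ev.write n) = obs δ (.app M (.num n)) Ev.done := by
  rw [obs_mkvar]
  ext s
  simp only [Set.mem_union, Set.mem_iUnion, exists_prop]
  constructor
  · rintro (⟨_, ⟨⟩, h⟩ | ⟨_, ⟨⟩, -⟩)
    exact h
  · exact fun h => .inl ⟨_, rfl, h⟩

theorem obs_mkvar_read (M : Term E Γ (.fn .nat .comm)) (N : Term E Γ .nat) (n : ℕ) :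
    obs δ (.mkvar M N) (Ev.read n) = obs δ N (Ev.num n) := by
  rw [obs_mkvar]
  ext s
  simp only [Set.mem_union, Set.mem_iUnion, exists_prop]
  constructor
  · rintro (⟨_, ⟨⟩, -⟩ | ⟨_, ⟨⟩, h⟩)
    exact h
  · exact fun h => .inr ⟨_, rfl, h⟩

/-- Discarding sizes. -/
def forget (Γ : Cxt) : SEnv Γ →* Set (Env Γ) := Set.singletonMonoidHom.comp (MonoidHom.fst _ _)

theorem forget_tick : forget Γ tick = 1 := rfl

theorem setOf_cons_mem_forget (w : FreeMonoid (Ev A)) (X : Set (SEnv (A :: Γ))) :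
    {s | Env.cons w s ∈ extend (forget _) X} = extend (forget _) {p | SEnv.cons w p ∈ X} := by
  simp only [forget, extend_ofHom]
  ext s
  constructor
  · rintro ⟨p, hp, e⟩
    refine ⟨(s, p.2), ?_, rfl⟩
    have : SEnv.cons w (s, p.2) = p := Prod.ext e.symm rfl
    exact this ▸ hp
  · rintro ⟨p, hp, rfl⟩
    exact ⟨_, hp, rfl⟩

/-- The denotation is the sized denotation without the sizes. -/
theorem obs_eq_extend_sden (M : Term E Γ A) (b : Ev A) :
    obs δ M b = extend (forget Γ) (sden δ M b) := by
  induction M with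
  | var x => rw [obs_var, sden, extend_singleton]; rfl
  | lam M ih =>
    rw [← Prod.mk.eta (p := b), obs_lam]
    simp only [ih, sden, setOf_cons_mem_forget]
  | num n => simp only [obs_num, sden, extend_iUnion, map_one]
  | skip => simp only [obs_skip, sden, map_one]
  | random => simp only [obs_random, sden, map_one]
  | new hB M ih =>
    simp only [obs_new, ih, sden, setOf_cons_mem_forget, map_mul, extend_singleton, forget_tick,
      one_mul, extend_iUnion]
  | deref M ih =>
    refine (obs_deref δ M b).trans ?_
    simp only [ih, sden, map_mul, extend_singleton, forget_tick, one_mul]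
  | ifzero hB M N₁ N₂ ih ih₁ ih₂ =>
    simp only [obs_ifzero, funext ih, funext ih₁, funext ih₂, sden, map_mul, extend_singleton,
      forget_tick, one_mul, extend_union, extend_iUnion]
  | mkvar M N ihM ihN =>
    simp only [obs_mkvar, obs_app, funext (obs_num δ _), funext ihM, funext ihN, sden, map_mul,
      map_one, extend_singleton, forget_tick, one_mul, extend_union, extend_iUnion, extend_lift]
  | _ =>
    rename_i ihM ihN
    simp only [obs_app, obs_op, obs_seq, obs_assign, obs_whileDo, funext ihM, funext ihN, sden,
      map_mul, map_pow, extend_singleton, forget_tick, one_mul, extend_iUnion, extend_lift]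

theorem mem_den_iff (M : Term E Γ A) (b : Ev A) (s : Env Γ) :
    (s, b) ∈ den δ M ↔ ∃ p ∈ sden δ M b, p.1 = s := by
  rw [← mem_obs, obs_eq_extend_sden, forget, extend_ofHom]
  rfl

theorem obs_weaken (M : Term E Γ A) (b : Ev A) :
    obs δ (M.weaken (B := B)) b = Env.cons 1 '' obs δ M b := by
  simp only [obs_eq_extend_sden, sden_weaken, forget, extend_ofHom, Set.image_image]
  rfl

theorem mem_obs_ofClosed {M : Term E [] A} {b : Ev A} {s : Env Γ} :
    s ∈ obs δ M.ofClosed b ↔ s = 1 ∧ 1 ∈ obs δ M b := by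
  simp only [mem_obs, mem_den_iff, sden_ofClosed, Set.mem_image]
  constructor
  · rintro ⟨_, ⟨p, hp, rfl⟩, rfl⟩
    exact ⟨rfl, p, hp, Env.eq_one _⟩
  · rintro ⟨rfl, p, hp, -⟩
    exact ⟨_, ⟨p, hp, rfl⟩, rfl⟩

/-- `β`-equality of affine terms. -/
theorem obs_beta (M : Term E (B :: Γ) A) (N : Term E Γ B)
    (hMN : Disjoint (Term.lam M).FV N.FV) (b : Ev A) :
    obs δ (.app (.lam M) N) b = obs δ (M.inst N) b := by
  rw [obs_eq_extend_sden, sden_beta δ M N hMN, map_mul, extend_singleton, forget_tick, one_mul,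
    ← obs_eq_extend_sden]

end Equations

/-! ### Free identifiers and the affine discipline -/

theorem mem_FV_rename {M : Term E Γ A} {ρ : Ren Γ Δ} {C : Ty} {y : Var Δ C} :
    ⟨C, y⟩ ∈ (M.rename ρ).FV ↔ ∃ x : Var Γ C, ⟨C, x⟩ ∈ M.FV ∧ ρ x = y := by
  induction M generalizing Δ with
  | var x =>
    simp only [Term.rename, Term.FV, Set.mem_singleton_iff]
    constructor
    · rintro ⟨⟩
      exact ⟨x, rfl, rfl⟩
    · rintro ⟨_, ⟨⟩, rfl⟩
      rfl
  | lam M ih =>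
    refine (ih (ρ := ρ.lift) (y := .s y)).trans ⟨?_, ?_⟩
    · rintro ⟨x, hx, e⟩
      cases x with
      | z => cases e
      | s x => exact ⟨x, hx, by cases e; rfl⟩
    · rintro ⟨x, hx, rfl⟩
      exact ⟨.s x, hx, rfl⟩
  | new hB M ih =>
    refine (ih (ρ := ρ.lift) (y := .s y)).trans ⟨?_, ?_⟩
    · rintro ⟨x, hx, e⟩
      cases x with
      | z => cases e
      | s x => exact ⟨x, hx, by cases e; rfl⟩
    · rintro ⟨x, hx, rfl⟩
      exact ⟨.s x, hx, rfl⟩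
  | _ => simp_all only [Term.rename, Term.FV, Set.mem_union, Set.mem_empty_iff_false, false_and,
      exists_false, or_and_right, exists_or]

theorem mem_FV_weaken {M : Term E Γ A} {C : Ty} {y : Var (B :: Γ) C} :
    ⟨C, y⟩ ∈ (M.weaken (B := B)).FV ↔ ∃ x : Var Γ C, ⟨C, x⟩ ∈ M.FV ∧ .s x = y :=
  mem_FV_rename

theorem FV_ofClosed (M : Term E [] A) : (M.ofClosed (Γ := Γ)).FV = ∅ := by
  refine Set.eq_empty_of_forall_notMem fun ⟨C, y⟩ h => ?_
  obtain ⟨x, -⟩ := mem_FV_rename.1 h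
  nomatch x

theorem disjoint_FV_rename {M : Term E Γ A} {N : Term E Γ B} {ρ : Ren Γ Δ}
    (hρ : ∀ C (x y : Var Γ C), ρ x = ρ y → x = y) (h : Disjoint M.FV N.FV) :
    Disjoint (M.rename ρ).FV (N.rename ρ).FV := by
  rw [Set.disjoint_left] at h ⊢
  rintro ⟨C, y⟩ hM hN
  obtain ⟨x, hx, rfl⟩ := mem_FV_rename.1 hM
  obtain ⟨x', hx', e⟩ := mem_FV_rename.1 hN
  cases hρ _ _ _ e
  exact h hx hx'

theorem Ren.lift_injective {ρ : Ren Γ Δ} (hρ : ∀ C (x y : Var Γ C), ρ x = ρ y → x = y) :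
    ∀ C (x y : Var (B :: Γ) C), (Ren.lift ρ : Ren (B :: Γ) _) x = Ren.lift ρ y → x = y := by
  intro C x y e
  cases x with
  | z =>
    cases y with
    | z => rfl
    | s y => cases e
  | s x =>
    cases y with
    | z => cases e
    | s y => rw [hρ C x y (by injection e)]

theorem isAffine_rename {M : Term E Γ A} {ρ : Ren Γ Δ}
    (hρ : ∀ C (x y : Var Γ C), ρ x = ρ y → x = y) (h : M.IsAffine) : (M.rename ρ).IsAffine := by
  induction M generalizing Δ with
  | lam M ih => exact ih (Ren.lift_injective hρ) h
  | new hB M ih => exact ih (Ren.lift_injective hρ) h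
  | app M N ihM ihN => exact ⟨ihM hρ h.1, ihN hρ h.2.1, disjoint_FV_rename hρ h.2.2⟩
  | var | num | skip | random => trivial
  | deref M ih => exact ih hρ h
  | ifzero hB M N₁ N₂ ihM ihN₁ ihN₂ => exact ⟨ihM hρ h.1, ihN₁ hρ h.2.1, ihN₂ hρ h.2.2⟩
  | _ =>
    rename_i ihM ihN
    exact ⟨ihM hρ h.1, ihN hρ h.2⟩

theorem isAffine_weaken {M : Term E Γ A} (h : M.IsAffine) : (M.weaken (B := B)).IsAffine :=
  isAffine_rename (fun C x y e => by injection e) h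

theorem isAffine_ofClosed {M : Term E [] A} (h : M.IsAffine) : (M.ofClosed (Γ := Γ)).IsAffine :=
  isAffine_rename (fun _ x => nomatch x) h

theorem mem_FV_subst {M : Term E Γ A} {θ : Sub E Γ Δ} {C : Ty} {y : Var Δ C}
    (h : ⟨C, y⟩ ∈ (M.subst θ).FV) : ∃ x : Σ D, Var Γ D, x ∈ M.FV ∧ ⟨C, y⟩ ∈ (θ x.2).FV := by
  induction M generalizing Δ with
  | var x => exact ⟨_, rfl, h⟩
  | lam M ih =>
    obtain ⟨⟨D, x⟩, hx, hy⟩ := ih (θ := θ.lift) h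
    cases x with
    | z => cases hy
    | s x =>
      obtain ⟨y', hy', e⟩ := mem_FV_weaken.1 hy
      cases e
      exact ⟨⟨D, x⟩, hx, hy'⟩
  | new hB M ih =>
    obtain ⟨⟨D, x⟩, hx, hy⟩ := ih (θ := θ.lift) h
    cases x with
    | z => cases hy
    | s x =>
      obtain ⟨y', hy', e⟩ := mem_FV_weaken.1 hy
      cases e
      exact ⟨⟨D, x⟩, hx, hy'⟩
  | ifzero hB M N₁ N₂ ihM ihN₁ ihN₂ =>
    rcases h with (h | h) | h
    · obtain ⟨x, hx, hy⟩ := ihM h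
      exact ⟨x, .inl (.inl hx), hy⟩
    · obtain ⟨x, hx, hy⟩ := ihN₁ h
      exact ⟨x, .inl (.inr hx), hy⟩
    · obtain ⟨x, hx, hy⟩ := ihN₂ h
      exact ⟨x, .inr hx, hy⟩
  | deref M ih => exact ih h
  | num | skip | random => exact absurd h (Set.notMem_empty _)
  | _ =>
    rename_i ihM ihN
    rcases h with h | h
    · obtain ⟨x, hx, hy⟩ := ihM h
      exact ⟨x, .inl hx, hy⟩
    · obtain ⟨x, hx, hy⟩ := ihN h
      exact ⟨x, .inr hx, hy⟩

/-- A substitution of affine terms with pairwise disjoint free identifiers for the identifiers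
in `S`. -/
structure Sub.IsAffineOn (θ : Sub E Γ Δ) (S : Set (Σ C, Var Γ C)) : Prop where
  affine : ∀ x ∈ S, (θ x.2).IsAffine
  disjoint : ∀ x ∈ S, ∀ y ∈ S, x ≠ y → Disjoint (θ x.2).FV (θ y.2).FV

theorem Sub.IsAffineOn.mono {θ : Sub E Γ Δ} {S T : Set (Σ C, Var Γ C)} (h : θ.IsAffineOn T)
    (hST : S ⊆ T) : θ.IsAffineOn S :=
  ⟨fun x hx => h.1 x (hST hx), fun x hx y hy => h.2 x (hST hx) y (hST hy)⟩

theorem Sub.IsAffineOn.lift {θ : Sub E Γ Δ} {S : Set (Σ C, Var (B :: Γ) C)}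
    (h : θ.IsAffineOn {y | (⟨y.1, .s y.2⟩ : Σ C, Var (B :: Γ) C) ∈ S}) :
    (θ.lift : Sub E (B :: Γ) _).IsAffineOn S := by
  have hz : ∀ {C : Ty} (x : Var Γ C), Disjoint (Term.var (.z : Var (B :: Δ) B) : Term E _ _).FV
      ((θ x).weaken (B := B)).FV := fun x => by
    rw [Set.disjoint_left]
    rintro _ rfl hy
    obtain ⟨_, -, e⟩ := mem_FV_weaken.1 hy
    cases e
  constructor
  · rintro ⟨C, x⟩ hx
    cases x with
    | z => trivial
    | s x => exact isAffine_weaken (h.1 ⟨C, x⟩ hx)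
  · rintro ⟨C, x⟩ hx ⟨D, y⟩ hy hxy
    cases x with
    | z =>
      cases y with
      | z => exact absurd rfl hxy
      | s y => exact hz y
    | s x =>
      cases y with
      | z => exact (hz x).symm
      | s y =>
        exact disjoint_FV_rename (fun C x y e => by injection e)
          (h.2 ⟨C, x⟩ hx ⟨D, y⟩ hy fun e => hxy (by cases e; rfl))

theorem isAffine_subst {M : Term E Γ A} {θ : Sub E Γ Δ} (hθ : θ.IsAffineOn M.FV)
    (h : M.IsAffine) : (M.subst θ).IsAffine := by
  induction M generalizing Δ with
  | var x => exact hθ.1 _ rfl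
  | lam M ih => exact ih hθ.lift h
  | new hB M ih => exact ih hθ.lift h
  | app M N ihM ihN =>
    refine ⟨ihM (hθ.mono fun x hx => .inl hx) h.1, ihN (hθ.mono fun x hx => .inr hx) h.2.1, ?_⟩
    rw [Set.disjoint_left]
    rintro ⟨C, z⟩ hM hN
    obtain ⟨x, hx, hxz⟩ := mem_FV_subst hM
    obtain ⟨y, hy, hyz⟩ := mem_FV_subst hN
    refine Set.disjoint_left.1 (hθ.2 x (.inl hx) y (.inr hy) ?_) hxz hyz
    rintro rfl
    exact Set.disjoint_left.1 h.2.2 hx hy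
  | ifzero hB M N₁ N₂ ihM ihN₁ ihN₂ =>
    exact ⟨ihM (hθ.mono fun x hx => .inl (.inl hx)) h.1,
      ihN₁ (hθ.mono fun x hx => .inl (.inr hx)) h.2.1, ihN₂ (hθ.mono fun x hx => .inr hx) h.2.2⟩
  | deref M ih => exact ih hθ h
  | num | skip | random => trivial
  | _ =>
    rename_i ihM ihN
    exact ⟨ihM (hθ.mono fun x hx => .inl hx) h.1, ihN (hθ.mono fun x hx => .inr hx) h.2⟩

theorem isAffine_inst {M : Term E (B :: Γ) A} {N : Term E Γ B}
    (h : (Term.app (.lam M) N).IsAffine) : (M.inst N).IsAffine := by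
  obtain ⟨hM, hN, hMN⟩ := h
  refine isAffine_subst ⟨?_, ?_⟩ hM
  · rintro ⟨C, x⟩ -
    cases x with
    | z => exact hN
    | s x => trivial
  · rintro ⟨C, x⟩ hx ⟨D, y⟩ hy hxy
    rw [Set.disjoint_left] at hMN
    cases x with
    | z =>
      cases y with
      | z => exact absurd rfl hxy
      | s y => exact Set.disjoint_singleton_right.2 fun h => hMN hy h
    | s x =>
      cases y with
      | z => exact Set.disjoint_singleton_left.2 fun h => hMN hx h
      | s y => exact Set.disjoint_singleton.2 fun e => hxy (by cases e; rfl)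

theorem FV_inst_subset (M : Term E (B :: Γ) A) (N : Term E Γ B) :
    (M.inst N).FV ⊆ (Term.app (.lam M) N).FV := by
  rintro ⟨C, y⟩ h
  obtain ⟨⟨D, x⟩, hx, hy⟩ := mem_FV_subst h
  cases x with
  | z => exact .inr hy
  | s x =>
    cases hy
    exact .inl hx

/-! ### Values -/

theorem Term.IsValue.of_weaken {V : Term E Γ A} (h : (V.weaken (B := B)).IsValue)
    (hA : A.IsGround) : V.IsValue := by
  cases V <;> first | constructor | cases h <;> cases hA

theorem Term.IsValue.eq_num {V : Term E Γ .nat} (h : V.IsValue) : ∃ n, V = .num n := by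
  cases h
  exact ⟨_, rfl⟩

theorem Term.IsValue.eq_skip {V : Term E Γ .comm} (h : V.IsValue) : V = .skip := by
  cases h
  rfl

theorem Term.IsValue.eq_lam {V : Term E Γ (.fn A B)} (h : V.IsValue) : ∃ M, V = .lam M := by
  cases h
  exact ⟨_, rfl⟩

theorem Term.IsValue.ground {V : Term E Γ A} (h : V.IsValue) (hA : A.IsGround) :
    V.IsAffine ∧ V.FV = ∅ := by
  cases h <;> first | exact ⟨trivial, rfl⟩ | cases hA

theorem Eval.isValue {δ : E → ℕ → ℕ → ℕ} {σ σ' : Store Γ} {M V : Term E Γ A}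
    (h : Eval δ σ M σ' V) : V.IsValue := by
  induction h with
  | value hV => exact hV
  | @new Γ B σ σ' n hB M V h ih => exact ih.of_weaken hB
  | op | random | deref => exact .num _
  | assign | while_exit | while_step => exact .skip
  | _ => assumption

theorem Eval.isAffine {δ : E → ℕ → ℕ → ℕ} {σ σ' : Store Γ} {M V : Term E Γ A}
    (h : Eval δ σ M σ' V) (hM : M.IsAffine) : V.IsAffine ∧ V.FV ⊆ M.FV := by
  induction h with
  | value hV => exact ⟨hM, subset_rfl⟩
  | app h₁ h₂ ih₁ ih₂ =>
    obtain ⟨hM, hN, hMN⟩ := hM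
    obtain ⟨h₁, h₁'⟩ := ih₁ hM
    obtain ⟨h₂, h₂'⟩ := ih₂ (isAffine_inst ⟨h₁, hN, hMN.mono_left h₁'⟩)
    exact ⟨h₂, h₂'.trans ((FV_inst_subset _ _).trans (Set.union_subset_union_left _ h₁'))⟩
  | op | random | deref => exact ⟨trivial, Set.empty_subset _⟩
  | assign | while_exit | while_step => exact ⟨trivial, Set.empty_subset _⟩
  | seq _ _ _ ih => exact ⟨(ih hM.2).1, (ih hM.2).2.trans Set.subset_union_right⟩
  | ifzero_zero _ _ _ ih =>
    exact ⟨(ih hM.2.1).1, (ih hM.2.1).2.trans fun x hx => .inl (.inr hx)⟩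
  | ifzero_ne _ _ _ _ ih => exact ⟨(ih hM.2.2).1, (ih hM.2.2).2.trans Set.subset_union_right⟩
  | @new Γ B σ σ' n hB M V h ih =>
    obtain ⟨hV, hV'⟩ := (h.isValue.of_weaken hB).ground hB
    exact ⟨hV, hV' ▸ Set.empty_subset _⟩
  | @assign_mkvar Γ _ _ _ _ M N n M₁ M₂ V h₁ h₂ h₃ ih₁ ih₂ ih₃ =>
    obtain ⟨hV, hV'⟩ := h₃.isValue.ground trivial
    exact ⟨hV, hV' ▸ Set.empty_subset _⟩
  | deref_mkvar h₁ h₂ ih₁ ih₂ =>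
    obtain ⟨hV, hV'⟩ := h₂.isValue.ground trivial
    exact ⟨hV, hV' ▸ Set.empty_subset _⟩

/-! ### Stores and traces -/

theorem trans_append {n n' : ℕ} {s t : List VarEv} :
    Trans n (s ++ t) n' ↔ ∃ m, Trans n s m ∧ Trans m t n' := by
  constructor
  · intro h
    induction s generalizing n with
    | nil => exact ⟨n, .nil n, h⟩
    | cons e s ih =>
      cases h with
      | read h =>
        obtain ⟨m, h₁, h₂⟩ := ih h
        exact ⟨m, .read h₁, h₂⟩
      | write h =>
        obtain ⟨m, h₁, h₂⟩ := ih h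
        exact ⟨m, .write h₁, h₂⟩
  · rintro ⟨m, h₁, h₂⟩
    induction h₁ with
    | nil => exact h₂
    | read _ ih => exact .read (ih h₂)
    | write _ ih => exact .write (ih h₂)

/-- The cells in the store `σ` can perform the sequences in `s`, and then `σ'` is the store. -/
def Steps (σ : Store Γ) (s : Env Γ) (σ' : Store Γ) : Prop :=
  ∀ x : Var Γ .var, Trans (σ x) (FreeMonoid.toList (s _ x)) (σ' x)

theorem steps_one {σ σ' : Store Γ} : Steps σ 1 σ' ↔ σ = σ' := by
  constructor
  · intro h
    funext x
    have : Trans (σ x) [] (σ' x) := h x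
    generalize σ' x = n at this
    cases this
    rfl
  · rintro rfl x
    exact .nil _

theorem steps_mul {σ σ' : Store Γ} {s t : Env Γ} :
    Steps σ (s * t) σ' ↔ ∃ σ₁, Steps σ s σ₁ ∧ Steps σ₁ t σ' := by
  constructor
  · intro h
    choose σ₁ h₁ h₂ using fun x => trans_append.1 (h x)
    exact ⟨σ₁, h₁, h₂⟩
  · rintro ⟨σ₁, h₁, h₂⟩ x
    exact trans_append.2 ⟨σ₁ x, h₁ x, h₂ x⟩

theorem Steps.mul {σ σ₁ σ' : Store Γ} {s t : Env Γ} (h₁ : Steps σ s σ₁) (h₂ : Steps σ₁ t σ') :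
    Steps σ (s * t) σ' := steps_mul.2 ⟨σ₁, h₁, h₂⟩

theorem steps_push {σ σ' : Store Γ} {m n : ℕ} {w : FreeMonoid (Ev .var)} {s : Env Γ} :
    Steps (σ.push m) (Env.cons w s) (σ'.push n) ↔
      Trans m (FreeMonoid.toList w) n ∧ Steps σ s σ' := by
  constructor
  · exact fun h => ⟨h .z, fun x => h (.s x)⟩
  · rintro ⟨h₁, h₂⟩ x
    cases x with
    | z => exact h₁
    | s x => exact h₂ x

theorem steps_single {σ σ' : Store Γ} {x : Var Γ .var} {w : FreeMonoid (Ev .var)} :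
    Steps σ (Env.single x w) σ' ↔
      Trans (σ x) (FreeMonoid.toList w) (σ' x) ∧ ∀ y, y ≠ x → σ y = σ' y := by
  have hne : ∀ y : Var Γ .var, y ≠ x → Env.single x w _ y = 1 := fun y hy =>
    Env.single_of_ne x w y fun e => hy (by cases e; rfl)
  constructor
  · refine fun h => ⟨by simpa using h x, fun y hy => ?_⟩
    have := h y
    rw [hne y hy] at this
    change Trans _ [] _ at this
    generalize σ' y = n at this
    cases this
    rfl
  · rintro ⟨h₁, h₂⟩ y
    by_cases hy : y = x
    · subst hy
      simpa using h₁
    · rw [hne y hy, h₂ y hy]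
      exact .nil _

theorem steps_read {σ σ' : Store Γ} {x : Var Γ .var} {n : ℕ} :
    Steps σ (Env.single x (FreeMonoid.of (Ev.read n))) σ' ↔ n = σ x ∧ σ' = σ := by
  rw [steps_single]
  constructor
  · rintro ⟨h₁, h₂⟩
    have : Trans (σ x) [.read n] (σ' x) := h₁
    generalize hm : σ x = m at this
    generalize hm' : σ' x = m' at this
    cases this with
    | read h =>
      cases h
      refine ⟨rfl, ?_⟩
      funext y
      by_cases hy : y = x
      · rw [hy, hm, hm']
      · exact (h₂ y hy).symm
  · rintro ⟨rfl, rfl⟩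
    exact ⟨.read (.nil _), fun _ _ => rfl⟩

theorem steps_write {σ σ' : Store Γ} {x : Var Γ .var} {n : ℕ} :
    Steps σ (Env.single x (FreeMonoid.of (Ev.write n))) σ' ↔ σ' = σ.set x n := by
  rw [steps_single]
  constructor
  · rintro ⟨h₁, h₂⟩
    have : Trans (σ x) [.write n] (σ' x) := h₁
    generalize hm' : σ' x = m' at this
    cases this with
    | write h =>
      cases h
      funext y
      by_cases hy : y = x
      · rw [Store.set, if_pos hy, hy, hm']
      · rw [Store.set, if_neg hy, h₂ y hy]
  · rintro rfl
    have : (σ.set x n) x = n := if_pos rfl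
    refine ⟨?_, fun y hy => (if_neg hy).symm⟩
    rw [this]
    exact .write (.nil _)

/-! ### Soundness -/

theorem obs_whileDo_step (δ : E → ℕ → ℕ → ℕ) (M : Term E Γ .nat) (N : Term E Γ .comm) :
    obs δ M (Ev.num 0) * obs δ N Ev.done * obs δ (.whileDo M N) Ev.done ⊆
      obs δ (.whileDo M N) Ev.done := by
  rw [obs_whileDo]
  rintro _ ⟨s, hs, t, ht, rfl⟩
  obtain ⟨j, m, hm, u, hu, v, hv, rfl⟩ := by simpa only [Set.mem_iUnion, exists_prop] using ht
  simp only [Set.mem_iUnion, exists_prop]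
  refine ⟨j + 1, m, hm, s * u, ?_, v, hv, mul_assoc _ _ _⟩
  rw [pow_succ']
  exact Set.mul_mem_mul hs hu

theorem obs_whileDo_exit (δ : E → ℕ → ℕ → ℕ) (M : Term E Γ .nat) (N : Term E Γ .comm) {m : ℕ}
    (hm : m ≠ 0) : obs δ M (Ev.num m) ⊆ obs δ (.whileDo M N) Ev.done := by
  rw [obs_whileDo]
  intro s hs
  simp only [Set.mem_iUnion, exists_prop]
  exact ⟨0, m, hm, 1, Set.mem_one.2 rfl, s, hs, one_mul _⟩

/-- An evaluation performs some sequences of events on the cells of the store; prefixing them to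
the events of the value gives events of the term. -/
theorem Eval.sound {δ : E → ℕ → ℕ → ℕ} {σ σ' : Store Γ} {M V : Term E Γ A}
    (h : Eval δ σ M σ' V) (hM : M.IsAffine) :
    ∃ s, Steps σ s σ' ∧ ∀ b, ∀ t ∈ obs δ V b, s * t ∈ obs δ M b := by
  have num : ∀ {Γ : Cxt} {M : Term E Γ .nat} {n : ℕ} {s : Env Γ},
      (∀ b, ∀ t ∈ obs δ (.num n : Term E Γ .nat) b, s * t ∈ obs δ M b) →
        s ∈ obs δ M (Ev.num n) := fun {Γ M n s} h => by
    simpa using h (Ev.num n) 1 (by rw [obs_num]; simp)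
  have skip : ∀ {Γ : Cxt} {M : Term E Γ .comm} {s : Env Γ},
      (∀ b, ∀ t ∈ obs δ (.skip : Term E Γ .comm) b, s * t ∈ obs δ M b) →
        s ∈ obs δ M Ev.done := fun {Γ M s} h => by
    simpa using h Ev.done 1 (by rw [obs_skip]; simp)
  have ofNum : ∀ {Γ : Cxt} {M : Term E Γ .nat} {n : ℕ} {s : Env Γ}, s ∈ obs δ M (Ev.num n) →
      ∀ b, ∀ t ∈ obs δ (.num n : Term E Γ .nat) b, s * t ∈ obs δ M b := fun {Γ M n s} h b t ht => by
    rw [obs_num] at ht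
    obtain ⟨rfl, rfl⟩ := Set.mem_iUnion.1 ht
    rwa [mul_one]
  have ofSkip : ∀ {Γ : Cxt} {M : Term E Γ .comm} {s : Env Γ}, s ∈ obs δ M Ev.done →
      ∀ b, ∀ t ∈ obs δ (.skip : Term E Γ .comm) b, s * t ∈ obs δ M b := fun {Γ M s} h b t ht => by
    rw [obs_skip] at ht
    rw [Set.mem_one.1 ht, mul_one]
    exact h
  induction h with
  | value hV => exact ⟨1, steps_one.2 rfl, fun b t ht => by rwa [one_mul]⟩
  | @app Γ A B σ σ₁ σ₂ M N M' V h₁ h₂ ih₁ ih₂ =>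
    obtain ⟨hM, hN, hMN⟩ := hM
    obtain ⟨h₁, h₁'⟩ := h₁.isAffine hM
    have hMN' := hMN.mono_left h₁'
    obtain ⟨s₁, hs₁, hM⟩ := ih₁ hM
    obtain ⟨s₂, hs₂, hV⟩ := ih₂ (isAffine_inst ⟨h₁, hN, hMN'⟩)
    refine ⟨s₁ * s₂, hs₁.mul hs₂, fun b t ht => ?_⟩
    have := hV b t ht
    rw [← obs_beta δ _ _ hMN', obs_app] at this
    obtain ⟨w, u, hu, v, hv, e⟩ := Set.mem_iUnion.1 this
    rw [obs_app]
    refine Set.mem_iUnion.2 ⟨w, s₁ * u, hM _ _ hu, v, hv, ?_⟩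
    change s₁ * u * v = _
    rw [mul_assoc, mul_assoc]
    exact congrArg _ e
  | op o h₁ h₂ ih₁ ih₂ =>
    obtain ⟨s₁, hs₁, h₁⟩ := ih₁ hM.1
    obtain ⟨s₂, hs₂, h₂⟩ := ih₂ hM.2
    refine ⟨s₁ * s₂, hs₁.mul hs₂, ofNum ?_⟩
    rw [obs_op]
    simp only [Set.mem_iUnion]
    exact ⟨_, _, rfl, Set.mul_mem_mul (num h₁) (num h₂)⟩
  | @assign Γ σ σ₁ σ₂ M N n x h₁ h₂ ih₁ ih₂ =>
    obtain ⟨s₁, hs₁, h₁⟩ := ih₁ hM.2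
    obtain ⟨s₂, hs₂, h₂⟩ := ih₂ hM.1
    refine ⟨s₁ * (s₂ * Env.single x (FreeMonoid.of (Ev.write n))),
      hs₁.mul (hs₂.mul (steps_write.2 rfl)), ofSkip ?_⟩
    rw [obs_assign]
    exact Set.mem_iUnion.2 ⟨n, Set.mul_mem_mul (num h₁) (h₂ _ _ (by rw [obs_var]; rfl))⟩
  | @deref Γ σ σ₁ M x h ih =>
    obtain ⟨s, hs, h⟩ := ih hM
    refine ⟨s * Env.single x (FreeMonoid.of (Ev.read (σ₁ x))),
      hs.mul (steps_read.2 ⟨rfl, rfl⟩), ofNum ?_⟩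
    rw [obs_deref]
    exact h _ _ (by rw [obs_var]; rfl)
  | seq h₁ h₂ ih₁ ih₂ =>
    obtain ⟨s₁, hs₁, h₁⟩ := ih₁ hM.1
    obtain ⟨s₂, hs₂, h₂⟩ := ih₂ hM.2
    refine ⟨s₁ * s₂, hs₁.mul hs₂, fun b t ht => ?_⟩
    rw [obs_seq, mul_assoc]
    exact Set.mul_mem_mul (skip h₁) (h₂ b t ht)
  | while_exit hn h ih =>
    obtain ⟨s, hs, h⟩ := ih hM.1
    exact ⟨s, hs, ofSkip (obs_whileDo_exit δ _ _ hn (num h))⟩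
  | while_step h₁ h₂ h₃ ih₁ ih₂ ih₃ =>
    obtain ⟨s₁, hs₁, h₁⟩ := ih₁ hM.1
    obtain ⟨s₂, hs₂, h₂⟩ := ih₂ hM.2
    obtain ⟨s₃, hs₃, h₃⟩ := ih₃ hM
    exact ⟨s₁ * s₂ * s₃, (hs₁.mul hs₂).mul hs₃, ofSkip (obs_whileDo_step δ _ _
      (Set.mul_mem_mul (Set.mul_mem_mul (num h₁) (skip h₂)) (skip h₃)))⟩
  | ifzero_zero h₁ h₂ ih₁ ih₂ =>
    obtain ⟨s₁, hs₁, h₁⟩ := ih₁ hM.1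
    obtain ⟨s₂, hs₂, h₂⟩ := ih₂ hM.2.1
    refine ⟨s₁ * s₂, hs₁.mul hs₂, fun b t ht => ?_⟩
    rw [obs_ifzero, mul_assoc]
    exact .inl (Set.mul_mem_mul (num h₁) (h₂ b t ht))
  | ifzero_ne hn h₁ h₂ ih₁ ih₂ =>
    obtain ⟨s₁, hs₁, h₁⟩ := ih₁ hM.1
    obtain ⟨s₂, hs₂, h₂⟩ := ih₂ hM.2.2
    refine ⟨s₁ * s₂, hs₁.mul hs₂, fun b t ht => ?_⟩
    rw [obs_ifzero, mul_assoc]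
    refine .inr ?_
    simp only [Set.mem_iUnion]
    exact ⟨_, hn, Set.mul_mem_mul (num h₁) (h₂ b t ht)⟩
  | @new Γ B σ σ' n hB M V h ih =>
    obtain ⟨s, hs, h⟩ := ih hM
    rw [← Env.cons_tail s] at hs
    obtain ⟨hw, hs⟩ := steps_push.1 hs
    refine ⟨s.tail, hs, fun b t ht => ?_⟩
    rw [obs_new]
    simp only [Set.mem_iUnion]
    refine ⟨_, ⟨n, hw⟩, ?_⟩
    have := h b (Env.cons 1 t) (by rw [obs_weaken]; exact ⟨t, ht, rfl⟩)
    rw [← Env.cons_tail s, Env.cons_mul, mul_one] at this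
    exact this
  | random n => exact ⟨1, steps_one.2 rfl, ofNum (by rw [obs_random]; rfl)⟩
  | @assign_mkvar Γ _ _ _ _ M N n M₁ M₂ V h₁ h₂ h₃ ih₁ ih₂ ih₃ =>
    obtain ⟨s₁, hs₁, h₁⟩ := ih₁ hM.2
    obtain ⟨h, -⟩ := h₂.isAffine hM.1
    obtain ⟨s₂, hs₂, h₂⟩ := ih₂ hM.1
    obtain ⟨s₃, hs₃, h₃⟩ := ih₃ ⟨h.1, trivial, Set.disjoint_empty _⟩
    refine ⟨s₁ * (s₂ * s₃), hs₁.mul (hs₂.mul hs₃), fun b t ht => ?_⟩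
    rw [obs_assign, mul_assoc, mul_assoc]
    exact Set.mem_iUnion.2 ⟨n, Set.mul_mem_mul (num h₁)
      (h₂ _ _ (by rw [obs_mkvar_write]; exact h₃ b t ht))⟩
  | deref_mkvar h₁ h₂ ih₁ ih₂ =>
    obtain ⟨h, -⟩ := h₁.isAffine hM
    obtain ⟨s₁, hs₁, h₁⟩ := ih₁ hM
    obtain ⟨s₂, hs₂, h₂⟩ := ih₂ h.2
    refine ⟨s₁ * s₂, hs₁.mul hs₂, fun b t ht => ?_⟩
    refine (obs_deref δ _ b).symm ▸ ?_
    rw [mul_assoc]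
    exact h₁ _ _ ((obs_mkvar_read δ _ _ b).symm ▸ h₂ b t ht)

/-! ### Adequacy -/

/-- The size component, as a natural number. -/
def SEnv.size (p : SEnv Γ) : ℕ := Multiplicative.toAdd p.2

@[simp]
theorem SEnv.size_mul (p q : SEnv Γ) : (p * q).size = p.size + q.size := rfl

@[simp]
theorem SEnv.size_tick : (tick : SEnv Γ).size = 1 := rfl

@[simp]
theorem SEnv.size_cons (w : FreeMonoid (Ev A)) (p : SEnv Γ) : (SEnv.cons w p).size = p.size := rfl

/-- Adequacy for sizes less than `k`: if a term over identifiers of type `var` produces an event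
in an environment that the store can perform, then it has a value, which produces the same event
in what remains of the environment. -/
def AdequateBelow (δ : E → ℕ → ℕ → ℕ) (k : ℕ) : Prop :=
  ∀ {Γ : Cxt} {A : Ty} (M : Term E Γ A) {b : Ev A} {p : SEnv Γ} {σ σ' : Store Γ},
    (∀ C, Var Γ C → C = .var) → M.IsAffine → p ∈ sden δ M b → p.size < k → Steps σ p.1 σ' →
      ∃ (V : Term E Γ A) (σ₁ : Store Γ) (q : SEnv Γ), Eval δ σ M σ₁ V ∧ q ∈ sden δ V b ∧
        q.size ≤ p.size ∧ Steps σ₁ q.1 σ'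

theorem AdequateBelow.eval_num {δ : E → ℕ → ℕ → ℕ} {k : ℕ} (h : AdequateBelow δ k)
    {M : Term E Γ .nat} {n : Ev .nat} {p : SEnv Γ} {σ σ' : Store Γ}
    (hΓ : ∀ C, Var Γ C → C = .var) (hM : M.IsAffine) (hp : p ∈ sden δ M n) (hk : p.size < k)
    (hσ : Steps σ p.1 σ') : Eval δ σ M σ' (.num n) := by
  obtain ⟨V, σ₁, q, hV, hq, -, hσ⟩ := h M hΓ hM hp hk hσ
  obtain ⟨m, rfl⟩ := hV.isValue.eq_num
  obtain ⟨rfl, rfl⟩ := Set.mem_iUnion.1 hq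
  obtain rfl := steps_one.1 hσ
  exact hV

theorem AdequateBelow.eval_skip {δ : E → ℕ → ℕ → ℕ} {k : ℕ} (h : AdequateBelow δ k)
    {M : Term E Γ .comm} {b : Ev .comm} {p : SEnv Γ} {σ σ' : Store Γ}
    (hΓ : ∀ C, Var Γ C → C = .var) (hM : M.IsAffine) (hp : p ∈ sden δ M b) (hk : p.size < k)
    (hσ : Steps σ p.1 σ') : Eval δ σ M σ' .skip := by
  obtain ⟨V, σ₁, q, hV, hq, -, hσ⟩ := h M hΓ hM hp hk hσ
  obtain rfl := hV.isValue.eq_skip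
  rw [Set.mem_one.1 hq] at hσ
  obtain rfl := steps_one.1 hσ
  exact hV

theorem adequateBelow (δ : E → ℕ → ℕ → ℕ) (k : ℕ) : AdequateBelow δ k := by
  induction k with
  | zero => exact fun _ _ _ _ _ _ _ _ h => absurd h (Nat.not_lt_zero _)
  | succ k ih =>
    intro Γ A M b p σ σ' hΓ hM hp hk hσ
    cases M with
    | var x =>
      obtain rfl := hΓ _ x
      exact ⟨_, σ, p, .value (.ident x), hp, le_rfl, hσ⟩
    | lam M => exact ⟨_, σ, p, .value (.lam M), hp, le_rfl, hσ⟩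
    | num n => exact ⟨_, σ, p, .value (.num n), hp, le_rfl, hσ⟩
    | skip => exact ⟨_, σ, p, .value .skip, hp, le_rfl, hσ⟩
    | mkvar M N => exact ⟨_, σ, p, .value (.mkvar M N), hp, le_rfl, hσ⟩
    | random =>
      refine ⟨.num b, σ, p, .random b, ?_, le_rfl, hσ⟩
      exact Set.mem_iUnion.2 ⟨rfl, hp⟩
    | app M N =>
      obtain ⟨hM, hN, hMN⟩ := hM
      simp only [sden, Set.mem_mul, Set.mem_iUnion, Set.mem_singleton_iff] at hp
      obtain ⟨_, rfl, _, ⟨w, u, hu, v, hv, rfl⟩, rfl⟩ := hp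
      simp only [SEnv.size_mul, SEnv.size_tick] at hk ⊢
      obtain ⟨σ₁, hσ₁, hσ₂⟩ := steps_mul.1 hσ
      obtain rfl := steps_one.1 hσ₁
      obtain ⟨σ₁, hσ₁, hσ₂⟩ := steps_mul.1 hσ₂
      obtain ⟨V, σ₂, q, hV, hq, hqu, hσ₃⟩ := ih M hΓ hM hu (by omega) hσ₁
      obtain ⟨M', rfl⟩ := hV.isValue.eq_lam
      obtain ⟨hM', hMM'⟩ := hV.isAffine hM
      have hMN' := hMN.mono_left hMM'
      have : tick * (q * v) ∈ sden δ (.app (.lam M') N) b := by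
        simp only [sden, Set.mem_mul, Set.mem_iUnion, Set.mem_singleton_iff]
        exact ⟨_, rfl, _, ⟨w, q, hq, v, hv, rfl⟩, rfl⟩
      -- Contracting the redex consumes the tick of the application.
      rw [sden_beta δ _ _ hMN', Set.singleton_mul] at this
      obtain ⟨r, hr, e⟩ := this
      obtain rfl := mul_left_cancel (a := tick) (b := r) (c := q * v) e
      obtain ⟨W, σ₄, r, hW, hr, hrq, hσ₄⟩ := ih _ hΓ
        (isAffine_inst (M := M') (N := N) ⟨hM', hN, hMN'⟩) hr
        (by simp only [SEnv.size_mul]; omega) (hσ₃.mul hσ₂)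
      simp only [SEnv.size_mul] at hrq
      exact ⟨W, σ₄, r, .app hV hW, hr, by omega, hσ₄⟩
    | op o M N =>
      simp only [sden, Set.mem_mul, Set.mem_iUnion, Set.mem_singleton_iff] at hp
      obtain ⟨_, rfl, _, ⟨m, n, rfl, u, hu, v, hv, rfl⟩, rfl⟩ := hp
      simp only [SEnv.size_mul, SEnv.size_tick] at hk
      obtain ⟨σ₁, hσ₁, hσ₂⟩ := steps_mul.1 hσ
      obtain rfl := steps_one.1 hσ₁
      obtain ⟨σ₁, hσ₁, hσ₂⟩ := steps_mul.1 hσ₂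
      exact ⟨_, σ', 1, .op o (ih.eval_num hΓ hM.1 hu (by omega) hσ₁)
        (ih.eval_num hΓ hM.2 hv (by omega) hσ₂), Set.mem_iUnion.2 ⟨rfl, rfl⟩, Nat.zero_le _,
        steps_one.2 rfl⟩
    | seq hB M N =>
      simp only [sden, Set.mem_mul, Set.mem_singleton_iff] at hp
      obtain ⟨_, rfl, _, ⟨u, hu, v, hv, rfl⟩, rfl⟩ := hp
      simp only [SEnv.size_mul, SEnv.size_tick] at hk ⊢
      obtain ⟨σ₁, hσ₁, hσ₂⟩ := steps_mul.1 hσ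
      obtain rfl := steps_one.1 hσ₁
      obtain ⟨σ₁, hσ₁, hσ₂⟩ := steps_mul.1 hσ₂
      obtain ⟨V, σ₂, q, hV, hq, hqv, hσ₃⟩ := ih N hΓ hM.2 hv (by omega) hσ₂
      exact ⟨V, σ₂, q, .seq (ih.eval_skip hΓ hM.1 hu (by omega) hσ₁) hV, hq, by omega, hσ₃⟩
    | assign M N =>
      simp only [sden, Set.mem_mul, Set.mem_iUnion, Set.mem_singleton_iff] at hp
      obtain ⟨_, rfl, _, ⟨n, u, hu, v, hv, rfl⟩, rfl⟩ := hp
      simp only [SEnv.size_mul, SEnv.size_tick] at hk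
      obtain ⟨σ₁, hσ₁, hσ₂⟩ := steps_mul.1 hσ
      obtain rfl := steps_one.1 hσ₁
      obtain ⟨σ₁, hσ₁, hσ₂⟩ := steps_mul.1 hσ₂
      have hN := ih.eval_num hΓ hM.2 hu (by omega) hσ₁
      obtain ⟨V, σ₂, q, hV, hq, hqv, hσ₃⟩ := ih M hΓ hM.1 hv (by omega) hσ₂
      suffices Eval δ σ (.assign M N) σ' .skip from
        ⟨_, σ', 1, this, rfl, Nat.zero_le _, steps_one.2 rfl⟩
      cases hV.isValue with
      | ident x =>
        obtain rfl := Set.mem_singleton_iff.1 hq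
        obtain rfl := steps_write.1 hσ₃
        exact .assign hN hV
      | mkvar M₁ M₂ =>
        obtain ⟨hM', -⟩ := hV.isAffine hM.1
        have : q ∈ sden δ (.app M₁ (.num n)) Ev.done := by
          rw [sden] at hq
          simp only [Set.mem_union, Set.mem_iUnion, exists_prop] at hq
          obtain (⟨_, ⟨⟩, h⟩ | ⟨_, ⟨⟩, -⟩) := hq
          exact h
        exact .assign_mkvar hN hV
          (ih.eval_skip hΓ ⟨hM'.1, trivial, Set.disjoint_empty _⟩ this (by omega) hσ₃)
    | deref M =>
      simp only [sden, Set.mem_mul, Set.mem_singleton_iff] at hp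
      obtain ⟨_, rfl, u, hu, rfl⟩ := hp
      simp only [SEnv.size_mul, SEnv.size_tick] at hk
      obtain ⟨σ₁, hσ₁, hσ₂⟩ := steps_mul.1 hσ
      obtain rfl := steps_one.1 hσ₁
      obtain ⟨V, σ₂, q, hV, hq, hqv, hσ₃⟩ := ih M hΓ hM hu (by omega) hσ₂
      suffices Eval δ σ (.deref M) σ' (.num b) from
        ⟨_, σ', 1, this, Set.mem_iUnion.2 ⟨rfl, rfl⟩, Nat.zero_le _, steps_one.2 rfl⟩
      cases hV.isValue with
      | ident x =>
        obtain rfl := Set.mem_singleton_iff.1 hq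
        obtain ⟨rfl, rfl⟩ := steps_read.1 hσ₃
        exact .deref hV
      | mkvar M₁ M₂ =>
        obtain ⟨hM', -⟩ := hV.isAffine hM
        have : q ∈ sden δ M₂ b := by
          rw [sden] at hq
          simp only [Set.mem_union, Set.mem_iUnion, exists_prop] at hq
          obtain (⟨_, ⟨⟩, -⟩ | ⟨_, ⟨⟩, h⟩) := hq
          exact h
        exact .deref_mkvar hV (ih.eval_num hΓ hM'.2 this (by omega) hσ₃)
    | whileDo M N =>
      suffices Eval δ σ (.whileDo M N) σ' .skip from
        ⟨_, σ', 1, this, rfl, Nat.zero_le _, steps_one.2 rfl⟩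
      simp only [sden, Set.mem_mul, Set.mem_iUnion, Set.mem_singleton_iff, exists_prop] at hp
      obtain ⟨_, rfl, _, ⟨j, m, hm, u, hu, v, hv, rfl⟩, rfl⟩ := hp
      simp only [SEnv.size_mul, SEnv.size_tick] at hk
      obtain ⟨σ₁, hσ₁, hσ₂⟩ := steps_mul.1 hσ
      obtain rfl := steps_one.1 hσ₁
      obtain ⟨σ₁, hσ₁, hσv⟩ := steps_mul.1 hσ₂
      cases j with
      | zero =>
        rw [pow_zero, Set.mem_one] at hu
        subst hu
        obtain rfl := steps_one.1 hσ₁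
        exact .while_exit hm (ih.eval_num hΓ hM.1 hv (by omega) hσv)
      | succ j =>
        rw [pow_succ'] at hu
        obtain ⟨_, ⟨_, rfl, _, ⟨x, hx, y, hy, rfl⟩, rfl⟩, r, hr, rfl⟩ := hu
        simp only [SEnv.size_mul, SEnv.size_tick] at hk
        obtain ⟨σ₃, hσ₁, hσ₃⟩ := steps_mul.1 hσ₁
        obtain ⟨σ₄, hσ₄, hσ₁⟩ := steps_mul.1 hσ₁
        obtain rfl := steps_one.1 hσ₄
        obtain ⟨σ₅, hσ₄, hσ₅⟩ := steps_mul.1 hσ₁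
        -- The remaining iterations have a tick of their own, which that of the first one pays for.
        have hrest : tick * (r * v) ∈ sden δ (.whileDo M N) b := by
          simp only [sden, Set.mem_mul, Set.mem_iUnion, Set.mem_singleton_iff, exists_prop]
          exact ⟨_, rfl, _, ⟨j, m, hm, r, hr, v, hv, rfl⟩, rfl⟩
        refine .while_step (ih.eval_num hΓ hM.1 hx (by omega) hσ₄)
          (ih.eval_skip hΓ hM.2 hy (by omega) hσ₅) (ih.eval_skip hΓ hM hrest ?_
            ((steps_one.2 rfl).mul (hσ₃.mul hσv)))
        simp only [SEnv.size_mul, SEnv.size_tick]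
        omega
    | ifzero hB M N₁ N₂ =>
      simp only [sden, Set.mem_mul, Set.mem_union, Set.mem_iUnion, Set.mem_singleton_iff,
        exists_prop] at hp
      obtain ⟨_, rfl, _, ⟨u, hu, v, hv, rfl⟩ | ⟨m, hm, u, hu, v, hv, rfl⟩, rfl⟩ := hp
      all_goals
        simp only [SEnv.size_mul, SEnv.size_tick] at hk ⊢
        obtain ⟨σ₁, hσ₁, hσ₂⟩ := steps_mul.1 hσ
        obtain rfl := steps_one.1 hσ₁
        obtain ⟨σ₁, hσ₁, hσ₂⟩ := steps_mul.1 hσ₂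
        have hM₀ := ih.eval_num hΓ hM.1 hu (by omega) hσ₁
      · obtain ⟨V, σ₂, q, hV, hq, hqv, hσ₃⟩ := ih N₁ hΓ hM.2.1 hv (by omega) hσ₂
        exact ⟨V, σ₂, q, .ifzero_zero hM₀ hV, hq, by omega, hσ₃⟩
      · obtain ⟨V, σ₂, q, hV, hq, hqv, hσ₃⟩ := ih N₂ hΓ hM.2.2 hv (by omega) hσ₂
        exact ⟨V, σ₂, q, .ifzero_ne hm hM₀ hV, hq, by omega, hσ₃⟩
    | new hB M =>
      simp only [sden, Set.mem_mul, Set.mem_iUnion, Set.mem_singleton_iff, exists_prop] at hp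
      obtain ⟨_, rfl, u, ⟨w, ⟨n, hw⟩, hu⟩, rfl⟩ := hp
      simp only [SEnv.size_mul, SEnv.size_tick] at hk
      obtain ⟨σ₁, hσ₁, hσ₂⟩ := steps_mul.1 hσ
      obtain rfl := steps_one.1 hσ₁
      have hΓ' : ∀ C, Var (.var :: Γ) C → C = .var := fun C x => by
        cases x with
        | z => rfl
        | s x => exact hΓ C x
      have hk' : (SEnv.cons w u).size < k := by
        rw [SEnv.size_cons]
        omega
      have hσ' : Steps (σ.push 0) (SEnv.cons w u).1 (σ'.push n) := steps_push.2 ⟨hw, hσ₂⟩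
      cases A with
      | nat =>
        exact ⟨.num b, σ', 1, .new (ih.eval_num hΓ' hM hu hk' hσ'), Set.mem_iUnion.2 ⟨rfl, rfl⟩,
          Nat.zero_le _, steps_one.2 rfl⟩
      | comm =>
        exact ⟨.skip, σ', 1, .new (ih.eval_skip hΓ' hM hu hk' hσ'), rfl, Nat.zero_le _,
          steps_one.2 rfl⟩
      | var => cases hB
      | fn A B => cases hB

theorem steps_nil (σ σ' : Store []) (s : Env []) : Steps σ s σ' := fun x => nomatch x

/-- Operational and denotational semantics agree on closed terms of type `nat`. -/
theorem converges_num_iff (δ : E → ℕ → ℕ → ℕ) {M : Term E [] .nat} (hM : M.IsAffine) (n : ℕ) :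
    Converges δ M (.num n) ↔ (1, Ev.num n) ∈ den δ M := by
  constructor
  · intro h
    obtain ⟨s, -, hs⟩ := h.sound hM
    have := hs (Ev.num n) 1 (by rw [obs_num]; simp)
    rwa [Env.eq_one s, mul_one] at this
  · intro h
    obtain ⟨p, hp, -⟩ := (mem_den_iff δ M _ _).1 h
    exact AdequateBelow.eval_num (adequateBelow δ _) (fun _ x => nomatch x) hM hp
      (Nat.lt_succ_self _) (steps_nil _ _ _)

/-- Operational and denotational semantics agree on closed terms of type `comm`. -/
theorem converges_skip_iff (δ : E → ℕ → ℕ → ℕ) {M : Term E [] .comm} (hM : M.IsAffine) :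
    Converges δ M .skip ↔ (1, Ev.done) ∈ den δ M := by
  constructor
  · intro h
    obtain ⟨s, -, hs⟩ := h.sound hM
    have := hs Ev.done 1 (by rw [obs_skip]; simp)
    rwa [Env.eq_one s, mul_one] at this
  · intro h
    obtain ⟨p, hp, -⟩ := (mem_den_iff δ M _ _).1 h
    exact AdequateBelow.eval_skip (adequateBelow δ _) (fun _ x => nomatch x) hM hp
      (Nat.lt_succ_self _) (steps_nil _ _ _)

/-! ### Auxiliary programs -/

theorem isGround_comm : Ty.comm.IsGround := trivial

theorem isBase_nat : Ty.nat.IsBase := trivial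

theorem isBase_comm : Ty.comm.IsBase := trivial

/-- The divergent command. -/
def diverge : Term E Γ .comm := .whileDo (.num 0) .skip

theorem mem_obs_num {δ : E → ℕ → ℕ → ℕ} {n : ℕ} {m : Ev .nat} {s : Env Γ} :
    s ∈ obs δ (.num n : Term E Γ .nat) m ↔ m = Ev.num n ∧ s = 1 := by
  simp only [obs_num, Set.mem_iUnion, exists_prop, Set.mem_one]

theorem obs_diverge (δ : E → ℕ → ℕ → ℕ) (b : Ev .comm) :
    obs δ (diverge : Term E Γ .comm) b = ∅ := by
  refine Set.eq_empty_of_forall_notMem fun s hs => ?_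
  rw [diverge, obs_whileDo] at hs
  simp only [Set.mem_iUnion, exists_prop] at hs
  obtain ⟨j, m, hm, u, -, v, hv, -⟩ := hs
  exact hm (mem_obs_num.1 hv).1

theorem Env.single_mul (x : Var Γ A) (v w : FreeMonoid (Ev A)) :
    Env.single x v * Env.single x w = Env.single x (v * w) := by
  induction x with
  | z => rw [Env.single_z, Env.single_z, Env.cons_mul, one_mul, Env.single_z]
  | s x ih => rw [Env.single_s, Env.single_s, Env.cons_mul, one_mul, ih, Env.single_s]

theorem Env.single_one (x : Var Γ A) : Env.single x 1 = 1 := by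
  induction x with
  | z => rw [Env.single_z, Env.cons_one]
  | s x ih => rw [Env.single_s, ih, Env.cons_one]

theorem lift_obs_var (δ : E → ℕ → ℕ → ℕ) (x : Var Γ A) (w : FreeMonoid (Ev A)) :
    FreeMonoid.lift (obs δ (.var x)) w = {Env.single x w} := by
  induction w using FreeMonoid.inductionOn' with
  | one => rw [map_one, Env.single_one]; rfl
  | of_mul a w ih =>
    rw [map_mul, FreeMonoid.lift_eval_of, ih, obs_var, Set.singleton_mul_singleton, Env.single_mul]

theorem mem_obs_app_ofClosed {δ : E → ℕ → ℕ → ℕ} {T : Term E [] (.fn A B)} {X : Term E Γ A}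
    {b : Ev B} {s : Env Γ} : s ∈ obs δ (.app T.ofClosed X) b ↔
      ∃ w, 1 ∈ obs δ T (Ev.fn w b) ∧ s ∈ FreeMonoid.lift (obs δ X) w := by
  rw [obs_app]
  simp only [Set.mem_iUnion, Set.mem_mul, mem_obs_ofClosed]
  constructor
  · rintro ⟨w, u, ⟨rfl, hu⟩, v, hv, rfl⟩
    exact ⟨w, hu, by rwa [one_mul]⟩
  · rintro ⟨w, hu, hs⟩
    exact ⟨w, 1, ⟨rfl, hu⟩, s, hs, one_mul s⟩

theorem disjoint_FV_ofClosed (T : Term E [] A) (S : Set (Σ C, Var Γ C)) :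
    Disjoint T.ofClosed.FV S := by
  rw [FV_ofClosed]
  exact Set.empty_disjoint S

/-- `T` is a closed affine term that terminates just when its argument is used to produce the
event `a` once. -/
structure Tests (δ : E → ℕ → ℕ → ℕ) (T : Term E [] (.fn A .comm)) (a : Ev A) : Prop where
  affine : T.IsAffine
  iff : ∀ w : FreeMonoid (Ev A), 1 ∈ obs δ T (Ev.fn w Ev.done) ↔ w = FreeMonoid.of a

/-- `G` is a closed affine term that denotes the event `a` alone. -/
structure Defines (δ : E → ℕ → ℕ → ℕ) (G : Term E [] A) (a : Ev A) : Prop where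
  affine : G.IsAffine
  iff : ∀ b : Ev A, 1 ∈ obs δ G b ↔ b = a

theorem Tests.obs_app {δ : E → ℕ → ℕ → ℕ} {T : Term E [] (.fn A .comm)} {a : Ev A}
    (hT : Tests δ T a) (X : Term E Γ A) :
    obs δ (.app T.ofClosed X) Ev.done = obs δ X a := by
  ext s
  simp [mem_obs_app_ofClosed, hT.iff]

theorem Tests.isAffine_app {δ : E → ℕ → ℕ → ℕ} {T : Term E [] (.fn A .comm)} {a : Ev A}
    (hT : Tests δ T a) {X : Term E Γ A} (hX : X.IsAffine) :
    (Term.app T.ofClosed X).IsAffine :=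
  ⟨isAffine_ofClosed hT.affine, hX, disjoint_FV_ofClosed _ _⟩

theorem Defines.mem_obs {δ : E → ℕ → ℕ → ℕ} {G : Term E [] A} {a : Ev A} (hG : Defines δ G a)
    {b : Ev A} {s : Env Γ} : s ∈ obs δ G.ofClosed b ↔ s = 1 ∧ b = a := by
  rw [mem_obs_ofClosed, hG.iff]

theorem obs_deref_var (δ : E → ℕ → ℕ → ℕ) (n : Ev .nat) :
    obs δ (.deref (.var (.z : Var (.var :: Γ) .var))) n =
      {Env.cons (FreeMonoid.of (Ev.read n)) 1} :=
  (obs_deref δ _ n).trans (obs_var δ _ _)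

theorem obs_assign_num (δ : E → ℕ → ℕ → ℕ) (n : ℕ) :
    obs δ (.assign (.var .z) (.num n) : Term E (.var :: Γ) .comm) Ev.done =
      {Env.cons (FreeMonoid.of (Ev.write n)) 1} := by
  rw [obs_assign]
  ext s
  simp only [obs_var, Set.mem_iUnion, Set.mem_mul, mem_obs_num, Set.mem_singleton_iff]
  constructor
  · rintro ⟨_, _, ⟨rfl, rfl⟩, _, rfl, rfl⟩
    exact one_mul _
  · rintro rfl
    exact ⟨_, 1, ⟨rfl, rfl⟩, _, rfl, one_mul _⟩

/-- The numeral `n` as a test of numbers: the argument is evaluated once, and its value is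
compared with `n`. -/
def eqTest (n : ℕ) : Term E [] (.fn .nat .comm) :=
  .lam (.new isGround_comm (.seq isBase_comm (.assign (.var .z) (.var (.s .z)))
    (.ifzero isBase_comm (.op .add (.op .sub (.deref (.var .z)) (.num n))
      (.op .sub (.num n) (.deref (.var .z)))) .skip diverge)))

theorem tests_eqTest (δ : E → ℕ → ℕ → ℕ) (n : ℕ) : Tests δ (eqTest n) (Ev.num n) := by
  refine ⟨by simp [eqTest, diverge, Term.IsAffine], fun w => ?_⟩
  rw [eqTest, obs_lam, Set.mem_ofPred_eq, obs_new]
  simp only [Set.mem_iUnion, exists_prop, Set.mem_ofPred_eq, obs_seq, obs_ifzero, obs_diverge,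
    Set.mul_empty, Set.iUnion_empty, Set.union_empty, obs_skip, mul_one, obs_assign, obs_op,
    obs_var, obs_num, obs_deref_var, Env.single_z, Env.single_s]
  constructor
  · rintro ⟨v, ⟨n', hv⟩, _, hs, _, ht, e⟩
    -- A number is stored and read twice; the cell makes the three occurrences agree.
    simp only [Set.mem_iUnion, exists_prop, Set.mem_mul, Set.mem_singleton_iff,
      Set.mem_one] at hs ht
    obtain ⟨k, _, rfl, _, rfl, rfl⟩ := hs
    obtain ⟨m, m', h₀, _, ⟨i, n₁, hm, _, rfl, _, ⟨hn₁, rfl⟩, rfl⟩,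
      _, ⟨n₂, j, hm', _, ⟨hn₂, rfl⟩, _, rfl, rfl⟩, rfl⟩ := ht
    simp only [mul_one, one_mul, Env.cons_mul, Env.cons_inj] at e
    obtain ⟨rfl, rfl, -⟩ := e
    change Trans 0 [.write k, .read i, .read j] n' at hv
    have h₀ : 0 = m + m' := h₀
    have hm : m = i - n₁ := hm
    have hm' : m' = n₂ - j := hm'
    have hn₁ : n₁ = n := hn₁
    have hn₂ : n₂ = n := hn₂
    cases hv with
    | write hv =>
      cases hv with
      | read hv =>
        cases hv with
        | read hv =>
          obtain rfl : k = n := by omega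
          rfl
  · rintro rfl
    refine ⟨FreeMonoid.ofList [.write n, .read n, .read n], ⟨n, .write (.read (.read (.nil n)))⟩,
      _, Set.mem_iUnion.2 ⟨n, Set.mul_mem_mul rfl rfl⟩,
      Env.cons (FreeMonoid.ofList [.read n, .read n]) 1, ?_, ?_⟩
    · have h₀ : Ev.num 0 = Ev.num (Op.eval δ .sub n n) := (Nat.sub_self n).symm
      simp only [Set.mem_iUnion, exists_prop, Set.mem_mul, Set.mem_singleton_iff, Set.mem_one]
      refine ⟨0, 0, rfl, _, ⟨n, n, h₀, _, rfl, _, ⟨rfl, rfl⟩, rfl⟩,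
        _, ⟨n, n, h₀, _, ⟨rfl, rfl⟩, _, rfl, rfl⟩, ?_⟩
      simp only [mul_one, one_mul, Env.cons_mul]
      rfl
    · simp only [mul_one, one_mul, Env.cons_mul]
      rfl

/-- Conditionals at all types: the extension of `ifzero` to function types by abstraction. -/
def ifA : (A : Ty) → {Γ : Cxt} → Term E Γ .nat → Term E Γ A → Term E Γ A → Term E Γ A
  | .nat, _, M, N₁, N₂ => .ifzero trivial M N₁ N₂
  | .comm, _, M, N₁, N₂ => .ifzero trivial M N₁ N₂
  | .var, _, M, N₁, N₂ => .ifzero trivial M N₁ N₂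
  | .fn _ B, _, M, N₁, N₂ =>
    .lam (ifA B M.weaken (.app N₁.weaken (.var .z)) (.app N₂.weaken (.var .z)))

theorem isAffine_eta {M : Term E Γ (.fn A B)} (hM : M.IsAffine) :
    (Term.app M.weaken (.var .z)).IsAffine := by
  refine ⟨isAffine_weaken hM, trivial, ?_⟩
  rw [Set.disjoint_left]
  rintro ⟨C, x⟩ hx hy
  obtain ⟨y, -, rfl⟩ := mem_FV_weaken.1 hx
  cases hy

theorem isAffine_ifA {M : Term E Γ .nat} {N₁ N₂ : Term E Γ A} (hM : M.IsAffine)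
    (h₁ : N₁.IsAffine) (h₂ : N₂.IsAffine) : (ifA A M N₁ N₂).IsAffine := by
  induction A generalizing Γ with
  | fn A B _ ih => exact ih (isAffine_weaken hM) (isAffine_eta h₁) (isAffine_eta h₂)
  | _ => exact ⟨hM, h₁, h₂⟩

/-- Abstraction undoes the weakening in the `η`-expansion of `M`. -/
theorem setOf_cons_mem_weaken_mul_eta (δ : E → ℕ → ℕ → ℕ) (X : Set (Env Γ))
    (M : Term E Γ (.fn A B)) (w : FreeMonoid (Ev A)) (b : Ev B) :
    {s | Env.cons w s ∈ Env.cons 1 '' X * obs δ (.app M.weaken (.var .z)) b} =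
      X * obs δ M (Ev.fn w b) := by
  ext s
  simp only [obs_app, obs_weaken, lift_obs_var, Set.mem_ofPred_eq, Set.mem_mul, Set.mem_image,
    Set.mem_iUnion, Set.mem_singleton_iff]
  constructor
  · rintro ⟨_, ⟨x, hx, rfl⟩, _, ⟨v, _, ⟨y, hy, rfl⟩, _, rfl, rfl⟩, e⟩
    rw [Env.single_z, Env.cons_mul, Env.cons_mul, Env.cons_inj, one_mul, one_mul, mul_one] at e
    obtain ⟨rfl, rfl⟩ := e
    exact ⟨x, hx, y, hy, rfl⟩
  · rintro ⟨x, hx, y, hy, rfl⟩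
    refine ⟨_, ⟨x, hx, rfl⟩, _, ⟨w, _, ⟨y, hy, rfl⟩, _, rfl, rfl⟩, ?_⟩
    rw [Env.single_z, Env.cons_mul, Env.cons_mul, one_mul, one_mul, mul_one]

theorem obs_ifA (δ : E → ℕ → ℕ → ℕ) (M : Term E Γ .nat) (N₁ N₂ : Term E Γ A) (b : Ev A) :
    obs δ (ifA A M N₁ N₂) b = obs δ M (Ev.num 0) * obs δ N₁ b ∪
      ⋃ (m : ℕ) (_ : m ≠ 0), obs δ M (Ev.num m) * obs δ N₂ b := by
  induction A generalizing Γ with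
  | fn A B _ ih =>
    obtain ⟨w, b⟩ := b
    refine (obs_lam δ _ w b).trans ?_
    rw [ih]
    simp only [← setOf_cons_mem_weaken_mul_eta, obs_weaken]
    ext s
    simp only [Set.mem_union, Set.mem_iUnion, Set.mem_ofPred_eq]
  | _ => exact obs_ifzero δ _ M N₁ N₂ b

/-- Sequential composition at all types. -/
def seqA (A : Ty) (M : Term E Γ .comm) (N : Term E Γ A) : Term E Γ A :=
  ifA A (.seq isBase_nat M (.num 0)) N N

theorem isAffine_seqA {M : Term E Γ .comm} {N : Term E Γ A} (hM : M.IsAffine) (hN : N.IsAffine) :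
    (seqA A M N).IsAffine := isAffine_ifA (M := .seq isBase_nat M (.num 0)) ⟨hM, trivial⟩ hN hN

theorem obs_seqA (δ : E → ℕ → ℕ → ℕ) (M : Term E Γ .comm) (N : Term E Γ A) (b : Ev A) :
    obs δ (seqA A M N) b = obs δ M Ev.done * obs δ N b := by
  rw [seqA, obs_ifA]
  ext s
  simp only [obs_seq, Set.mem_union, Set.mem_iUnion, Set.mem_mul, mem_obs_num, exists_prop]
  constructor
  · rintro (⟨_, ⟨u, hu, _, ⟨-, rfl⟩, rfl⟩, v, hv, rfl⟩ | ⟨m, hm, _, ⟨u, -, _, ⟨h, -⟩, -⟩, -⟩)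
    · exact ⟨u, hu, v, hv, by rw [mul_one]⟩
    · exact absurd h hm
  · rintro ⟨u, hu, v, hv, rfl⟩
    exact .inl ⟨u * 1, ⟨u, hu, 1, ⟨trivial, rfl⟩, rfl⟩, v, hv, by rw [mul_one]⟩

/-- Erratic choice at all types. -/
def orA (A : Ty) (N₁ N₂ : Term E Γ A) : Term E Γ A := ifA A .random N₁ N₂

theorem isAffine_orA {N₁ N₂ : Term E Γ A} (h₁ : N₁.IsAffine) (h₂ : N₂.IsAffine) :
    (orA A N₁ N₂).IsAffine := isAffine_ifA trivial h₁ h₂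

theorem obs_orA (δ : E → ℕ → ℕ → ℕ) (N₁ N₂ : Term E Γ A) (b : Ev A) :
    obs δ (orA A N₁ N₂) b = obs δ N₁ b ∪ obs δ N₂ b := by
  rw [orA, obs_ifA]
  simp only [obs_random, one_mul]
  refine congrArg _ (Set.ext fun s => ?_)
  simp only [Set.mem_iUnion, exists_prop]
  exact ⟨fun ⟨_, _, h⟩ => h, fun h => ⟨1, one_ne_zero, h⟩⟩

theorem nonempty_ev (A : Ty) : Nonempty (Ev A) := by
  induction A with
  | nat => exact ⟨Ev.num 0⟩
  | comm => exact ⟨Ev.done⟩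
  | var => exact ⟨Ev.read 0⟩
  | fn A B _ ih => exact ⟨Ev.fn 1 ih.some⟩

/-! ### Definability -/

/-- The events of a counter by which its value is found to be `i` and increased by one. -/
def tickEvents (i : ℕ) : FreeMonoid (Ev .var) :=
  FreeMonoid.of (Ev.read i) * FreeMonoid.of (Ev.write (i + 1))

/-- Offering the events of a list in turn: there is a term that produces the event in position
`j` of the list `l` when the counter held by its identifier has the value `i + j`, increasing the
counter. -/
theorem exists_enumerate {δ : E → ℕ → ℕ → ℕ} (hA : ∀ a : Ev A, ∃ G : Term E [] A, Defines δ G a)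
    (l : List (Ev A)) (i : ℕ) : ∃ H : Term E [.var] A, H.IsAffine ∧ ∀ a s, s ∈ obs δ H a ↔
      ∃ j, l[j]? = some a ∧ s = Env.cons (tickEvents (i + j)) 1 := by
  induction l generalizing i with
  | nil =>
    -- Diverging at type `A` takes some term of this type to be sequenced with.
    obtain ⟨G, hG⟩ := hA (nonempty_ev A).some
    refine ⟨seqA A diverge G.ofClosed, isAffine_seqA (by simp [diverge, Term.IsAffine])
      (isAffine_ofClosed hG.affine), fun a s => ?_⟩
    simp [obs_seqA, obs_diverge]
  | cons a l ih =>
    obtain ⟨G, hG⟩ := hA a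
    obtain ⟨H, hH, hH'⟩ := ih (i + 1)
    have ht := tests_eqTest δ i
    let guard : Term E [.var] .comm := .seq isBase_comm
      (.app (eqTest i).ofClosed (.deref (.var .z))) (.assign (.var .z) (.num (i + 1)))
    have hguard : guard.IsAffine :=
      ⟨ht.isAffine_app (X := .deref (.var .z)) trivial, trivial, trivial⟩
    refine ⟨orA A (seqA A guard G.ofClosed) H,
      isAffine_orA (isAffine_seqA hguard (isAffine_ofClosed hG.affine)) hH, fun b s => ?_⟩
    rw [obs_orA, obs_seqA, obs_seq, ht.obs_app, obs_deref_var, obs_assign_num,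
      Set.singleton_mul_singleton, Env.cons_mul, mul_one, Set.mem_union, hH']
    have : s ∈ ({Env.cons (FreeMonoid.of (Ev.read i) * FreeMonoid.of (Ev.write (i + 1))) 1} :
        Set (Env [.var])) * obs δ G.ofClosed b ↔ a = b ∧ s = Env.cons (tickEvents i) 1 := by
      simp only [Set.singleton_mul, Set.mem_image, hG.mem_obs]
      constructor
      · rintro ⟨_, ⟨rfl, rfl⟩, rfl⟩
        exact ⟨rfl, mul_one _⟩
      · rintro ⟨rfl, rfl⟩
        exact ⟨1, ⟨rfl, rfl⟩, mul_one _⟩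
    rw [this]
    constructor
    · rintro (⟨rfl, rfl⟩ | ⟨j, hj, rfl⟩)
      · exact ⟨0, rfl, rfl⟩
      · exact ⟨j + 1, hj, by rw [Nat.add_right_comm, Nat.add_assoc]⟩
    · rintro ⟨j, hj, rfl⟩
      cases j with
      | zero => exact .inl ⟨Option.some.inj hj, rfl⟩
      | succ j => exact .inr ⟨j, hj, by rw [Nat.add_right_comm, Nat.add_assoc]⟩

/-- When the counter starts at `m` and must hold the length of `l` at the end, an argument that
offers the events of `l` in turn can only be used for those from position `m` on. -/
theorem eq_drop_of_trans {f : Ev A → Set (Env Γ)} {x : Var Γ .var} {l : List (Ev A)}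
    (hf : ∀ a s, s ∈ f a ↔ ∃ j, l[j]? = some a ∧ s = Env.single x (tickEvents j))
    (w : FreeMonoid (Ev A)) (s : Env Γ) (hs : s ∈ FreeMonoid.lift f w) (m n : ℕ)
    (h : Trans m (FreeMonoid.toList (s _ x) ++ [.read l.length]) n) :
    w = FreeMonoid.ofList (l.drop m) ∧ ∃ v, s = Env.single x v := by
  induction w using FreeMonoid.inductionOn' generalizing s m with
  | one =>
    rw [map_one, Set.mem_one] at hs
    subst hs
    change Trans m [.read l.length] n at h
    cases h
    exact ⟨by rw [List.drop_length]; rfl, 1, (Env.single_one x).symm⟩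
  | of_mul a w ih =>
    rw [map_mul, FreeMonoid.lift_eval_of] at hs
    obtain ⟨_, hu, t, ht, rfl⟩ := hs
    obtain ⟨j, hj, rfl⟩ := (hf _ _).1 hu
    change Trans m (FreeMonoid.toList (α := VarEv) (Env.single x (tickEvents j) _ x * t _ x) ++
      [VarEv.read l.length] : List VarEv) n at h
    rw [Env.single_self] at h
    change Trans m
      (.read j :: .write (j + 1) :: (FreeMonoid.toList (α := VarEv) (t _ x) ++ _)) n at h
    cases h with
    | read h =>
      cases h with
      | write h =>
        obtain ⟨rfl, v, rfl⟩ := ih t ht _ h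
        refine ⟨?_, tickEvents m * v, Env.single_mul x _ _⟩
        obtain ⟨hm, rfl⟩ := List.getElem?_eq_some_iff.1 hj
        rw [List.drop_eq_getElem_cons hm]
        rfl

/-- An argument that offers the events of `l` in turn can be used for those from position `m` on,
which takes the counter from `m` to the length of `l`. -/
theorem exists_trans_drop {f : Ev A → Set (Env Γ)} {x : Var Γ .var} {l : List (Ev A)}
    (hf : ∀ a s, s ∈ f a ↔ ∃ j, l[j]? = some a ∧ s = Env.single x (tickEvents j))
    (m k : ℕ) (hm : m + k = l.length) :
    ∃ v, Env.single x v ∈ FreeMonoid.lift f (FreeMonoid.ofList (l.drop m)) ∧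
      Trans m (FreeMonoid.toList v) l.length := by
  induction k generalizing m with
  | zero =>
    obtain rfl : m = l.length := hm
    refine ⟨1, ?_, .nil _⟩
    rw [List.drop_length, Env.single_one]
    exact Set.mem_one.2 rfl
  | succ k ih =>
    obtain ⟨v, hv, hv'⟩ := ih (m + 1) (by omega)
    refine ⟨tickEvents m * v, ?_, .read (.write hv')⟩
    have hj : m < l.length := by omega
    rw [List.drop_eq_getElem_cons hj, FreeMonoid.ofList_cons, map_mul, FreeMonoid.lift_eval_of,
      ← Env.single_mul]
    have hm' := List.getElem?_eq_getElem hj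
    exact Set.mul_mem_mul ((hf _ _).2 ⟨m, hm', rfl⟩) hv

/-- Testing a sequence of events one after the other. -/
theorem exists_test_list {δ : E → ℕ → ℕ → ℕ}
    (hA : ∀ a : Ev A, ∃ T : Term E [] (.fn A .comm), Tests δ T a) (w : FreeMonoid (Ev A)) :
    ∃ X : Term E [A] .comm, X.IsAffine ∧ obs δ X Ev.done = {Env.cons w 1} := by
  induction w using FreeMonoid.inductionOn' with
  | one => exact ⟨.skip, trivial, by rw [obs_skip, Env.cons_one]; rfl⟩
  | of_mul a w ih =>
    obtain ⟨T, hT⟩ := hA a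
    obtain ⟨X, hX, hX'⟩ := ih
    refine ⟨.seq isBase_comm (.app T.ofClosed (.var .z)) X, ⟨hT.isAffine_app trivial, hX⟩, ?_⟩
    rw [obs_seq, hT.obs_app, hX', obs_var, Set.singleton_mul_singleton, Env.single_z,
      Env.cons_mul, mul_one]

/-- Every event of every type can be tested for, and can be defined. The two statements are proved
together by induction on the type: a function is tested on an argument that offers the required
events in turn, and a function is defined by testing its argument. -/
theorem exists_tests_and_defines (δ : E → ℕ → ℕ → ℕ) (A : Ty) :
    (∀ a : Ev A, ∃ T : Term E [] (.fn A .comm), Tests δ T a) ∧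
      ∀ a : Ev A, ∃ G : Term E [] A, Defines δ G a := by
  induction A with
  | nat => exact ⟨fun n => ⟨_, tests_eqTest δ n⟩, fun n => ⟨.num n, trivial, fun m => by
      rw [mem_obs_num (n := n)]; exact and_iff_left rfl⟩⟩
  | comm =>
    refine ⟨fun _ => ⟨.lam (.var .z), trivial, fun w => ?_⟩, fun a => ⟨.skip, trivial, fun b => ?_⟩⟩
    · rw [obs_lam, Set.mem_ofPred_eq, obs_var, Set.mem_singleton_iff, Env.single_z, Env.cons_inj]
      exact and_iff_left rfl
    · exact ⟨fun _ => rfl, fun _ => rfl⟩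
  | var =>
    constructor
    · rintro (n | n)
      · have hn := tests_eqTest δ n
        refine ⟨.lam (.app (eqTest n).ofClosed (.deref (.var .z))),
          hn.isAffine_app (X := .deref (.var .z)) trivial, fun w => ?_⟩
        rw [obs_lam, Set.mem_ofPred_eq, hn.obs_app, obs_deref_var, Set.mem_singleton_iff,
          Env.cons_inj]
        exact and_iff_left rfl
      · refine ⟨.lam (.assign (.var .z) (.num n)), ⟨trivial, trivial⟩, fun w => ?_⟩
        rw [obs_lam, Set.mem_ofPred_eq, obs_assign_num, Set.mem_singleton_iff, Env.cons_inj]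
        exact and_iff_left rfl
    · rintro (n | n)
      · refine ⟨.mkvar (.lam diverge) (.num n), ⟨⟨trivial, trivial⟩, trivial⟩, ?_⟩
        rintro (m | m)
        · rw [obs_mkvar_read δ _ _ m, mem_obs_num]
          exact ⟨fun h => congrArg _ h.1, fun h => ⟨VarEv.read.inj h, rfl⟩⟩
        · rw [obs_mkvar_write δ _ _ m, obs_app]
          simp [obs_lam, obs_diverge]
      · have hn := tests_eqTest δ n
        refine ⟨.mkvar (eqTest n) (.seq isBase_nat diverge (.num 0)),
          ⟨hn.affine, ⟨trivial, trivial⟩, trivial⟩, ?_⟩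
        rintro (m | m)
        · rw [obs_mkvar_read δ _ _ m, obs_seq, obs_diverge]
          simp
        · rw [obs_mkvar_write δ _ _ m, obs_app]
          simp only [Set.mem_iUnion, Set.mem_mul]
          constructor
          · rintro ⟨w, u, hu, v, hv, -⟩
            rw [Env.eq_one u, hn.iff] at hu
            rw [hu, FreeMonoid.lift_eval_of] at hv
            exact congrArg _ (mem_obs_num.1 hv).1.symm
          · intro h
            obtain rfl := VarEv.write.inj h
            exact ⟨_, 1, (hn.iff _).2 rfl, 1, mem_obs_num.2 ⟨rfl, rfl⟩, one_mul _⟩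
  | fn A B ihA ihB =>
    obtain ⟨hTA, hGA⟩ := ihA
    obtain ⟨hTB, hGB⟩ := ihB
    constructor
    · rintro ⟨w, b⟩
      obtain ⟨T, hT⟩ := hTB b
      set l := FreeMonoid.toList w with hl
      obtain ⟨H, hH, hH'⟩ := exists_enumerate hGA l 0
      have hn := tests_eqTest δ l.length
      set Y : Term E [.var, .fn A B] A := .app (Term.lam H).ofClosed (.var .z) with hY
      have hf : ∀ a s, s ∈ obs δ Y a ↔ ∃ j, l[j]? = some a ∧ s = Env.single .z (tickEvents j) := by
        intro a s
        rw [hY, mem_obs_app_ofClosed]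
        simp only [obs_lam, Set.mem_ofPred_eq, hH', Env.cons_inj, lift_obs_var,
          Set.mem_singleton_iff, zero_add]
        constructor
        · rintro ⟨_, ⟨j, hj, rfl, -⟩, rfl⟩
          exact ⟨j, hj, rfl⟩
        · rintro ⟨j, hj, rfl⟩
          exact ⟨_, ⟨j, hj, rfl, trivial⟩, rfl⟩
      refine ⟨.lam (.new isGround_comm (.seq isBase_comm
        (.app T.ofClosed (.app (.var (.s .z)) Y))
        (.app (eqTest l.length).ofClosed (.deref (.var .z))))), ⟨hT.isAffine_app ⟨trivial,
          ⟨isAffine_ofClosed hH, trivial, disjoint_FV_ofClosed _ _⟩, ?_⟩,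
          hn.isAffine_app trivial⟩, fun W => ?_⟩
      · refine Set.disjoint_singleton_left.2 ?_
        rintro (h | h)
        · rw [FV_ofClosed] at h
          exact h
        · cases h
      · rw [obs_lam, Set.mem_ofPred_eq, obs_new]
        simp only [Set.mem_iUnion, exists_prop, Set.mem_ofPred_eq, obs_seq, hT.obs_app, hn.obs_app,
          obs_deref_var, obs_app, obs_var, Set.mem_mul, Set.mem_singleton_iff]
        constructor
        · rintro ⟨v, ⟨n, hv⟩, _, ⟨w', _, rfl, u, hu, rfl⟩, _, rfl, e⟩
          -- The component of `e` at the counter determines the use of the argument, and that at the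
          -- function is the claim.
          have e₀ : u _ .z * FreeMonoid.of (Ev.read l.length) = v := congrFun (congrFun e _) .z
          rw [← e₀] at hv
          obtain ⟨rfl, v, rfl⟩ := eq_drop_of_trans hf w' u hu 0 n hv
          exact (congrFun (congrFun e _) (.s .z)).symm
        · rintro rfl
          obtain ⟨v, hv, hv'⟩ := exists_trans_drop hf 0 l.length (Nat.zero_add _)
          refine ⟨v * FreeMonoid.of (Ev.read l.length), ⟨l.length,
            trans_append.2 ⟨_, hv', .read (.nil _)⟩⟩, _, ⟨w, _, rfl, _, hv, rfl⟩, _, rfl, ?_⟩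
          simp only [Env.single_s, Env.single_z, Env.cons_mul, one_mul, mul_one]
    · rintro ⟨w, b⟩
      obtain ⟨G, hG⟩ := hGB b
      obtain ⟨X, hX, hX'⟩ := exists_test_list hTA w
      refine ⟨.lam (seqA B X G.ofClosed), isAffine_seqA hX (isAffine_ofClosed hG.affine), ?_⟩
      rintro ⟨w', b'⟩
      have h := obs_lam δ (seqA B X G.ofClosed) w' b'
      change 1 ∈ obs δ _ (Ev.fn w' b') ↔ _
      rw [h, Set.mem_ofPred_eq, obs_seqA, hX', Set.singleton_mul]
      simp only [Set.mem_image, hG.mem_obs]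
      constructor
      · rintro ⟨_, ⟨rfl, rfl⟩, e⟩
        rw [mul_one, Env.cons_inj] at e
        rw [e.1]
      · intro e
        obtain ⟨rfl, rfl⟩ := Prod.ext_iff.1 e
        exact ⟨1, ⟨rfl, rfl⟩, mul_one _⟩

/-! ### Full abstraction -/

theorem den_fill_congr {δ : E → ℕ → ℕ → ℕ} {M N : Term E [] A} (h : den δ M = den δ N)
    (C : Hole E A Γ B) : den δ (C.fill M) = den δ (C.fill N) := by
  induction C with
  | hole =>
    ext ⟨s, b⟩
    rw [Hole.fill, Hole.fill, ← mem_obs, ← mem_obs, mem_obs_ofClosed, mem_obs_ofClosed, mem_obs,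
      mem_obs, h]
  | _ =>
    rename_i ih
    simp only [Hole.fill, den, ih]

theorem converges_congr {δ : E → ℕ → ℕ → ℕ} {M N : Term E [] A} (hA : A.IsGround)
    (hM : M.IsAffine) (hN : N.IsAffine) (h : den δ M = den δ N) {V : Term E [] A}
    (hV : V.IsValue) : Converges δ M V ↔ Converges δ N V := by
  cases A with
  | nat =>
    obtain ⟨n, rfl⟩ := hV.eq_num
    rw [converges_num_iff δ hM, converges_num_iff δ hN, h]
  | comm =>
    obtain rfl := hV.eq_skip
    rw [converges_skip_iff δ hM, converges_skip_iff δ hN, h]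
  | _ => cases hA

theorem sem_eq_iff {δ : E → ℕ → ℕ → ℕ} {M N : Term E Γ A} :
    sem δ M = sem δ N ↔ den δ M = den δ N := by
  refine ⟨fun h => ?_, fun h => congrArg (MonRel.ofPairs (A := cxtObj Γ)) h⟩
  have h' := FreeMonoid.lift.injective h
  ext ⟨s, b⟩
  exact Set.ext_iff.1 (congrFun h' b) s

end SCI

/-- Full abstraction of the model in `MonRel` of the language with erratic choice and bad
variables. -/
theorem mainTheorem2 {E : Type} (δ : E → ℕ → ℕ → ℕ) {A : SCI.Ty} (M N : SCI.Term E [] A)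
    (hM : M.IsAffine) (hN : N.IsAffine) :
    SCI.sem δ M = SCI.sem δ N ↔ SCI.CtxEquiv δ M N := by
  rw [SCI.sem_eq_iff]
  constructor
  · intro h B hB C hCM hCN V hV
    exact SCI.converges_congr hB hCM hCN (SCI.den_fill_congr h C) hV
  · intro h
    ext ⟨s, a⟩
    obtain ⟨T, hT⟩ := (SCI.exists_tests_and_defines δ A).1 a
    have hTM := hT.isAffine_app (SCI.isAffine_ofClosed (Γ := []) hM)
    have hTN := hT.isAffine_app (SCI.isAffine_ofClosed (Γ := []) hN)
    have := h .comm trivial (.app_arg T.ofClosed .hole) hTM hTN .skip .skip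
    rw [SCI.Hole.fill, SCI.Hole.fill, SCI.Hole.fill, SCI.Hole.fill,
      SCI.converges_skip_iff δ hTM, SCI.converges_skip_iff δ hTN, ← SCI.mem_obs, ← SCI.mem_obs,
      hT.obs_app, hT.obs_app, SCI.mem_obs_ofClosed, SCI.mem_obs_ofClosed] at this
    rw [SCI.Env.eq_one s]
    simpa [SCI.mem_obs] using this
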